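/- Let $M,J_1,J_2\ge 1$ be integers, let $h_1,\dots,h_{J_1}\in\mathbb{R}^M$ be distinct, let $g_1,\dots,g_{J_2}\in\mathbb{R}^M$ be distinct, and assume that any collection of $M$ or fewer vectors of the set $\{h_1,\dots,h_{J_1}\}\cup\{g_1,\dots,g_{J_2}\}$ is linearly independent. Consider the compound private broadcast channel, in which at each time $t=1,\dots,n$ the transmitter sends $x(t)\in\mathbb{R}^M$ and the receivers of the two groups observe $$y_j(t)=h_j^Tx(t)+v_j(t)\quad(1\le j\le J_1),\qquad z_k(t)=g_k^Tx(t)+w_k(t)\quad(1\le k\le J_2),$$ where all the noise variables $v_j(t),w_k(t)$ are i.i.d. $\mathcal N(0,1)$ and independent of the messages and of the input. A code of block length $n$ consists of two independent messages $m_1,m_2$, uniform on finite non-empty sets of sizes $N_1,N_2$, a (stochastic) encoder mapping $(m_1,m_2)$ to the input sequence $x^n=(x(1),\dots,x(n))$, a decoder estimating $m_1$ from $y_j^n$ for each $j$, and a decoder estimating $m_2$ from $z_k^n$ for each $k$. It satisfies the power constraint $P$ if $\frac1n\sum_{t=1}^n E\|x(t)\|^2\le P$. A rate pair $(R_1,R_2)$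 is achievable with power $P$ if there are codes, one for each block length $n$, satisfying the power constraint $P$, such that as $n\to\infty$: $\frac1n\log_2N_i\to R_i$ for $i=1,2$; the probability that at least one receiver decodes its group's message incorrectly tends to $0$; and $\frac1nI(m_1;z_k^n)\to0$ and $\frac1nI(m_2;y_j^n)\to0$ for all $k$ and $j$. A number $d$ is an achievable sum secrecy degree of freedom if there are rate pairs $(R_1(P),R_2(P))$, achievable with power $P$ for each $P>0$, such that $\frac{R_1(P)+R_2(P)}{\frac12\log_2P}\to d$ as $P\to\infty$. The sum secrecy degrees of freedom $d^s$ of the channel is the supremum of the achievable $d$. Then $$d^s\le\begin{cases}2,&\max(J_1,J_2)<M,\\[2pt] \dfrac{2M-1}{M},&\min(J_1,J_2)<M\le\max(J_1,J_2),\\[2pt] \dfrac{2(M-1)}{M},&\min(J_1,J_2)\ge M.\end{cases}$$ -/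

import Mathlib

open MeasureTheory ProbabilityTheory Filter Topology
open scoped ENNReal

noncomputable section

namespace CompoundPrivateBroadcast

/-- The mutual information `I(X;Y)` (in nats) of two random variables on `(Ω, μ)`: the
Kullback-Leibler divergence of the joint law from the product of the marginal laws. -/
def mutualInfo {Ω α β : Type*} [MeasurableSpace Ω] [MeasurableSpace α] [MeasurableSpace β]
    (X : Ω → α) (Y : Ω → β) (μ : Measure Ω) : ℝ≥0∞ :=
  InformationTheory.klDiv (μ.map (fun ω => (X ω, Y ω))) ((μ.map X).prod (μ.map Y))

/-- Any collection of at most `M` distinct vectors of `{h₁,…} ∪ {g₁,…}` is linearly independent. -/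
def AnyIndependent {M J₁ J₂ : ℕ} (h : Fin J₁ → EuclideanSpace ℝ (Fin M))
    (g : Fin J₂ → EuclideanSpace ℝ (Fin M)) : Prop :=
  ∀ S : Finset (EuclideanSpace ℝ (Fin M)), (S : Set (EuclideanSpace ℝ (Fin M))) ⊆
    Set.range h ∪ Set.range g → S.card ≤ M →
      LinearIndepOn ℝ id (S : Set (EuclideanSpace ℝ (Fin M)))

/-- A private broadcast code of block length `n` for `M` transmit antennas and groups of `J₁` and
`J₂` receivers: message set sizes, a (stochastic) encoder from message pairs to input sequences
`x(1), …, x(n) ∈ ℝᴹ`, and one decoder for each receiver of each group. -/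
structure Code (M J₁ J₂ n : ℕ) where
  /-- size of the set of messages for group 1 -/
  N₁ : ℕ
  /-- size of the set of messages for group 2 -/
  N₂ : ℕ
  N₁_pos : 0 < N₁
  N₂_pos : 0 < N₂
  /-- the encoder: law of the input sequence given the message pair -/
  encoder : Kernel (Fin N₁ × Fin N₂) (Fin n → EuclideanSpace ℝ (Fin M))
  isMarkovKernel_encoder : IsMarkovKernel encoder
  /-- decoders of group 1 -/
  dec₁ : Fin J₁ → (Fin n → ℝ) → Fin N₁
  /-- decoders of group 2 -/
  dec₂ : Fin J₂ → (Fin n → ℝ) → Fin N₂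
  measurable_dec₁ : ∀ j, Measurable (dec₁ j)
  measurable_dec₂ : ∀ k, Measurable (dec₂ k)

namespace Code

variable {M J₁ J₂ n : ℕ} (c : Code M J₁ J₂ n)

/-- Sample space: message pair, input sequence, and the noise sequences of all receivers. -/
abbrev Sample : Type :=
  ((Fin c.N₁ × Fin c.N₂) × (Fin n → EuclideanSpace ℝ (Fin M))) × (Fin J₁ ⊕ Fin J₂ → Fin n → ℝ)

/-- The law of the message pair and the input sequence: the messages are independent and uniform,
and the input sequence is produced by the encoder. -/
def inputLaw : Measure ((Fin c.N₁ × Fin c.N₂) × (Fin n → EuclideanSpace ℝ (Fin M))) :=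
  ((uniformOn (Set.univ : Set (Fin c.N₁))).prod (uniformOn (Set.univ : Set (Fin c.N₂)))).compProd
    c.encoder

/-- The law on the sample space: all noise variables are i.i.d. standard Gaussian, and independent
of the messages and the input. -/
def law : Measure c.Sample :=
  c.inputLaw.prod (Measure.pi fun _ => Measure.pi fun _ => gaussianReal 0 1)

/-- The message for group 1. -/
def msg₁ (ω : c.Sample) : Fin c.N₁ := ω.1.1.1

/-- The message for group 2. -/
def msg₂ (ω : c.Sample) : Fin c.N₂ := ω.1.1.2

/-- The sequence received by receiver `j` of group 1: `y_j(t) = h_jᵀ x(t) + v_j(t)`. -/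
def output₁ (h : Fin J₁ → EuclideanSpace ℝ (Fin M)) (j : Fin J₁) (ω : c.Sample) : Fin n → ℝ :=
  fun t => inner ℝ (h j) (ω.1.2 t) + ω.2 (Sum.inl j) t

/-- The sequence received by receiver `k` of group 2: `z_k(t) = g_kᵀ x(t) + w_k(t)`. -/
def output₂ (g : Fin J₂ → EuclideanSpace ℝ (Fin M)) (k : Fin J₂) (ω : c.Sample) : Fin n → ℝ :=
  fun t => inner ℝ (g k) (ω.1.2 t) + ω.2 (Sum.inr k) t

/-- The average power constraint `(1/n) ∑ₜ E[‖x(t)‖²] ≤ P`. -/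
def SatisfiesPower (P : ℝ) : Prop :=
  ∫⁻ ω, ∑ t, ‖ω.2 t‖ₑ ^ 2 ∂c.inputLaw ≤ ENNReal.ofReal (n * P)

/-- The probability that some receiver decodes the message of its group incorrectly. -/
def errorProb (h : Fin J₁ → EuclideanSpace ℝ (Fin M))
    (g : Fin J₂ → EuclideanSpace ℝ (Fin M)) : ℝ≥0∞ :=
  c.law ({ω | ∃ j, c.dec₁ j (c.output₁ h j ω) ≠ c.msg₁ ω} ∪
    {ω | ∃ k, c.dec₂ k (c.output₂ g k ω) ≠ c.msg₂ ω})

/-- The rate, in bits per channel use, of message 1. -/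
def rate₁ : ℝ := Real.logb 2 c.N₁ / n

/-- The rate, in bits per channel use, of message 2. -/
def rate₂ : ℝ := Real.logb 2 c.N₂ / n

end Code

/-- `(R₁, R₂)` is an achievable rate pair under the power constraint `P`: there are codes, one for
each block length `n`, whose rates tend to `R₁` and `R₂`, whose error probability tends to `0`, and
for which `(1/n) I(m₁; z_kⁿ) → 0` and `(1/n) I(m₂; y_jⁿ) → 0` for all `k` and `j`. -/
def AchievableRatePair {M J₁ J₂ : ℕ} (h : Fin J₁ → EuclideanSpace ℝ (Fin M))
    (g : Fin J₂ → EuclideanSpace ℝ (Fin M)) (P R₁ R₂ : ℝ) : Prop :=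
  ∃ c : (n : ℕ) → Code M J₁ J₂ n,
    (∀ n, (c n).SatisfiesPower P) ∧
    Tendsto (fun n => (c n).rate₁) atTop (𝓝 R₁) ∧
    Tendsto (fun n => (c n).rate₂) atTop (𝓝 R₂) ∧
    Tendsto (fun n => (c n).errorProb h g) atTop (𝓝 0) ∧
    (∀ k, Tendsto (fun n : ℕ =>
      mutualInfo (c n).msg₁ ((c n).output₂ g k) (c n).law / (n : ℝ≥0∞)) atTop (𝓝 0)) ∧
    (∀ j, Tendsto (fun n : ℕ =>
      mutualInfo (c n).msg₂ ((c n).output₁ h j) (c n).law / (n : ℝ≥0∞)) atTop (𝓝 0))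

/-- `d` is an achievable sum secrecy d.o.f.: there are achievable rate pairs `(R₁(P), R₂(P))` with
`(R₁(P) + R₂(P)) / ((1/2) log₂ P) → d` as `P → ∞`. -/
def AchievableSumDOF {M J₁ J₂ : ℕ} (h : Fin J₁ → EuclideanSpace ℝ (Fin M))
    (g : Fin J₂ → EuclideanSpace ℝ (Fin M)) (d : ℝ) : Prop :=
  ∃ R₁ R₂ : ℝ → ℝ, (∀ P, 0 < P → AchievableRatePair h g P (R₁ P) (R₂ P)) ∧
    Tendsto (fun P => (R₁ P + R₂ P) / (1 / 2 * Real.logb 2 P)) atTop (𝓝 d)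

/-- The sum secrecy d.o.f. of the compound private broadcast channel: the supremum, in the extended
reals, of the achievable values. -/
def sumSecrecyDOF {M J₁ J₂ : ℕ} (h : Fin J₁ → EuclideanSpace ℝ (Fin M))
    (g : Fin J₂ → EuclideanSpace ℝ (Fin M)) : EReal :=
  sSup {e : EReal | ∃ d : ℝ, AchievableSumDOF h g d ∧ e = (d : EReal)}

end CompoundPrivateBroadcast

end

/-!
Write `H(y)` for the differential entropy of a received sequence of length `n`, which is finite
because the density of a Gaussian-smoothed law lies between a Gaussian and a constant. The bound
rests on three facts about a good code, the first two valid up to `o(n)`.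

* A receiver that decodes a message loses the rate of that message when the message is given:
  `H(y_j) - H(y_j | m₁) ≥ n R₁` (`fano`).
* A receiver from which a message is kept secret loses nothing: `H(z_k | m₁) ≥ H(z_k)`
  (`entropy_sub_le_klDiv`).
* If the channel vector of `z` is a linear combination of those of `y_1, …, y_M`, then
  `H(z | m) ≤ ∑ j, H(y_j | m) + O(n)`, the constant being independent of the input and hence of
  the power (`entropy_map_lin_le`).

By independence, `M` receivers of one group determine the input, so if group 1 has that many,
`M n R₁ ≤ ∑ j, H(y_j) - ∑ j, H(y_j | m₁) ≤ ∑ j, H(y_j) - H(z_k)` up to `O(n)`, for every `k`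
(`EntropyProfile.mul_add_le`). Together with `H ≤ n (½ log (1 + P) + O(1))` (`entropy_le`) and with
`n R₂ ≤ H(z_k)` this gives `M (R₁ + R₂) ≤ (2M - 1) ½ log P + O(1)`. If both groups have at least `M`
receivers, averaging the inequality over `k` and adding its mirror image gives
`M (R₁ + R₂) ≤ 2 (M - 1) ½ log P + O(1)`. With fewer receivers only the single-receiver bounds
remain, whose sum is `2 · ½ log P + O(1)`.

All entropy inequalities are instances of one principle, Gibbs' inequality in the form
`∫ f dP ≤ ∫ exp f dP - 1` (`integral_le_of_lintegral_exp_le`), applied to the logarithm of a test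
density divided by the true density.
-/

noncomputable section

namespace CompoundPrivateBroadcast

/-! ### Product densities -/

theorem lintegral_fin_prod {n : ℕ} {α : Type*} [MeasurableSpace α]
    (μ : Fin n → Measure α) [∀ i, SigmaFinite (μ i)] (f : Fin n → α → ℝ≥0∞)
    (hf : ∀ i, Measurable (f i)) :
    ∫⁻ x, ∏ i, f i (x i) ∂(Measure.pi μ) = ∏ i, ∫⁻ x, f i x ∂(μ i) := by
  induction n with
  | zero => simp
  | succ n ih =>
    have e := (measurePreserving_piFinSuccAbove μ 0).symm
    rw [← e.lintegral_comp_emb (MeasurableEquiv.measurableEmbedding _)]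
    simp_rw [MeasurableEquiv.piFinSuccAbove_symm_apply, Fin.insertNthEquiv,
      Fin.prod_univ_succ, Fin.insertNth_zero]
    simp only [Equiv.coe_fn_mk, Fin.cons_succ, Fin.cons_zero, Fin.zero_succAbove, cast_eq]
    rw [lintegral_prod_mul (g := fun x : Fin n → α => ∏ i, f i.succ (x i)) (hf 0).aemeasurable (by
      refine Measurable.aemeasurable ?_
      exact Finset.measurable_fun_prod _ fun i _ => (hf i.succ).comp (measurable_pi_apply i))]
    rw [ih (fun i => μ i.succ) (fun i => f i.succ) (fun i => hf i.succ)]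

theorem pi_withDensity {n : ℕ} {α : Type*} [MeasurableSpace α]
    (μ : Measure α) [SigmaFinite μ] (f : Fin n → α → ℝ≥0∞) (hf : ∀ i, Measurable (f i))
    [∀ i, SigmaFinite (μ.withDensity (f i))] :
    Measure.pi (fun i => μ.withDensity (f i)) =
      (Measure.pi fun _ => μ).withDensity fun x => ∏ i, f i (x i) := by
  refine Measure.pi_eq fun s hs => ?_
  rw [withDensity_apply _ (MeasurableSet.univ_pi hs), Measure.restrict_pi_pi,
    lintegral_fin_prod _ _ hf]
  exact Finset.prod_congr rfl fun i _ => (withDensity_apply _ (hs i)).symm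

/-! ### Gibbs' inequality -/

/-- Gibbs' inequality in variational form, a consequence of `f + 1 ≤ exp f`. -/
theorem integral_le_of_lintegral_exp_le {Ω : Type*} [MeasurableSpace Ω] {P : Measure Ω}
    [IsProbabilityMeasure P] {f : Ω → ℝ} (hf : Integrable f P) {a : ℝ} (ha : 0 ≤ a)
    (h : ∫⁻ ω, ENNReal.ofReal (Real.exp (f ω)) ∂P ≤ ENNReal.ofReal a) :
    ∫ ω, f ω ∂P ≤ a - 1 := by
  have hm : AEStronglyMeasurable (fun ω => Real.exp (f ω)) P :=
    Real.continuous_exp.comp_aestronglyMeasurable hf.1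
  have hint : Integrable (fun ω => Real.exp (f ω)) P := by
    rw [← lintegral_ofReal_ne_top_iff_integrable hm (ae_of_all _ fun _ => (Real.exp_pos _).le)]
    exact ne_top_of_le_ne_top ENNReal.ofReal_ne_top h
  have h1 : ∫ ω, Real.exp (f ω) ∂P ≤ a := by
    rw [integral_eq_lintegral_of_nonneg_ae (ae_of_all _ fun _ => (Real.exp_pos _).le) hm]
    exact ENNReal.toReal_le_of_le_ofReal ha h
  have h2 : ∫ ω, (f ω + 1) ∂P ≤ ∫ ω, Real.exp (f ω) ∂P :=
    integral_mono (hf.add (integrable_const 1)) hint fun ω => Real.add_one_le_exp (f ω)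
  rw [integral_add hf (integrable_const 1)] at h2
  simp at h2
  linarith

/-- The Donsker-Varadhan lower bound for the Kullback-Leibler divergence. -/
theorem ofReal_integral_le_klDiv {Ω : Type*} [MeasurableSpace Ω] {P Q : Measure Ω}
    [IsProbabilityMeasure P] [IsProbabilityMeasure Q] {f : Ω → ℝ} (hfm : Measurable f)
    (hf : Integrable f P)
    (h : ∫⁻ ω, ENNReal.ofReal (Real.exp (f ω)) ∂Q ≤ 1) :
    ENNReal.ofReal (∫ ω, f ω ∂P) ≤ InformationTheory.klDiv P Q := by
  by_cases htop : InformationTheory.klDiv P Q = ∞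
  · simp [htop]
  obtain ⟨hac, hint⟩ := InformationTheory.klDiv_ne_top_iff.1 htop
  rw [InformationTheory.klDiv_of_ac_of_integrable hac hint]
  refine ENNReal.ofReal_le_ofReal ?_
  simp only [probReal_univ, add_sub_cancel_right]
  have key : ∫ ω, (f ω - llr P Q ω) ∂P ≤ 1 - 1 := by
    refine integral_le_of_lintegral_exp_le (hf.sub hint) zero_le_one ?_
    rw [← lintegral_rnDeriv_mul hac (by
      have := measurable_llr P Q
      fun_prop)]
    rw [ENNReal.ofReal_one]
    refine le_trans (lintegral_mono_ae ?_) h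
    filter_upwards [P.rnDeriv_lt_top Q] with ω hω
    by_cases h0 : P.rnDeriv Q ω = 0
    · simp [h0]
    have hpos : 0 < (P.rnDeriv Q ω).toReal := ENNReal.toReal_pos h0 hω.ne
    rw [llr_def, Pi.sub_apply, Real.exp_sub, Real.exp_log hpos, ← ENNReal.ofReal_toReal hω.ne,
      ← ENNReal.ofReal_mul (by positivity)]
    rw [ENNReal.toReal_ofReal (by positivity), mul_div_cancel₀ _ hpos.ne']
  rw [integral_sub hf hint] at key
  linarith

/-! ### Gaussian noise -/

/-- The squared Euclidean length of a block of `n` real symbols. -/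
def energy {n : ℕ} (v : Fin n → ℝ) : ℝ := ∑ t, v t ^ 2

/-- The density of `n` i.i.d. centred Gaussian variables of variance `s`. -/
def gaussianDensity {n : ℕ} (s : ℝ) (v : Fin n → ℝ) : ℝ :=
  Real.exp (-(energy v / (2 * s)) - n / 2 * Real.log (2 * Real.pi * s))

/-- The law of `n` i.i.d. standard Gaussian variables. -/
def noise (n : ℕ) : Measure (Fin n → ℝ) := Measure.pi fun _ => gaussianReal 0 1

instance (n : ℕ) : IsProbabilityMeasure (noise n) := by unfold noise; infer_instance

variable {n : ℕ}

theorem energy_nonneg (v : Fin n → ℝ) : 0 ≤ energy v := Finset.sum_nonneg fun _ _ => sq_nonneg _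

@[fun_prop]
theorem measurable_energy : Measurable (energy (n := n)) := by unfold energy; fun_prop

theorem energy_add_le (u v : Fin n → ℝ) : energy (u + v) ≤ 2 * energy u + 2 * energy v := by
  simp only [energy, Finset.mul_sum, ← Finset.sum_add_distrib, Pi.add_apply]
  exact Finset.sum_le_sum fun t _ => by nlinarith [sq_nonneg (u t - v t)]

theorem energy_sub_le (u v : Fin n → ℝ) : energy (u - v) ≤ 2 * energy u + 2 * energy v := by
  simp only [energy, Finset.mul_sum, ← Finset.sum_add_distrib, Pi.sub_apply]
  exact Finset.sum_le_sum fun t _ => by nlinarith [sq_nonneg (u t + v t)]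

theorem gaussianDensity_pos (s : ℝ) (v : Fin n → ℝ) : 0 < gaussianDensity s v := Real.exp_pos _

@[fun_prop]
theorem measurable_gaussianDensity (s : ℝ) : Measurable (gaussianDensity (n := n) s) := by
  unfold gaussianDensity; fun_prop

theorem gaussianDensity_eq_prod {s : NNReal} (hs : s ≠ 0) (v : Fin n → ℝ) :
    ENNReal.ofReal (gaussianDensity s v) = ∏ t, gaussianPDF 0 s (v t) := by
  have hs' : (0 : ℝ) < s := NNReal.coe_pos.2 (pos_iff_ne_zero.2 hs)
  simp only [gaussianPDF]
  rw [← ENNReal.ofReal_prod_of_nonneg fun t _ => gaussianPDFReal_nonneg _ _ _]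
  congr 1
  have h1 : ∀ x : ℝ, gaussianPDFReal 0 s x =
      Real.exp (-(x ^ 2 / (2 * s)) - 1 / 2 * Real.log (2 * Real.pi * s)) := by
    intro x
    rw [gaussianPDFReal, sub_zero, sub_eq_add_neg, Real.exp_add, mul_comm, neg_div]
    congr 1
    rw [Real.sqrt_eq_rpow, ← Real.rpow_neg (by positivity), Real.rpow_def_of_pos (by positivity)]
    congr 1; ring
  simp only [h1, ← Real.exp_sum]
  unfold gaussianDensity energy
  congr 1
  rw [Finset.sum_sub_distrib, Finset.sum_neg_distrib, Finset.sum_div]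
  simp
  ring

theorem pi_gaussianReal_eq_withDensity {s : NNReal} (hs : s ≠ 0) :
    Measure.pi (fun _ : Fin n => gaussianReal 0 s) =
      volume.withDensity fun v => ENNReal.ofReal (gaussianDensity s v) := by
  have : ∀ t : Fin n, IsProbabilityMeasure (volume.withDensity (gaussianPDF 0 s)) := by
    intro t; rw [← gaussianReal_of_var_ne_zero 0 hs]; infer_instance
  simp_rw [gaussianDensity_eq_prod hs, gaussianReal_of_var_ne_zero 0 hs]
  exact pi_withDensity volume (fun _ : Fin n => gaussianPDF 0 s)
    fun _ => measurable_gaussianPDF 0 s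

theorem lintegral_gaussianDensity {s : ℝ} (hs : 0 < s) :
    ∫⁻ v : Fin n → ℝ, ENNReal.ofReal (gaussianDensity s v) = 1 := by
  lift s to NNReal using hs.le
  have h := pi_gaussianReal_eq_withDensity (n := n) (s := s) (by rintro rfl; simp at hs)
  have h2 := congrArg (fun m => m Set.univ) h
  simpa using h2.symm

theorem noise_eq_withDensity :
    noise n = volume.withDensity fun v => ENNReal.ofReal (gaussianDensity 1 v) :=
  pi_gaussianReal_eq_withDensity (n := n) one_ne_zero

theorem integrable_sq_gaussianReal : Integrable (fun x : ℝ => x ^ 2) (gaussianReal 0 1) :=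
  (memLp_id_gaussianReal 2).integrable_sq

theorem integral_sq_gaussianReal : ∫ x : ℝ, x ^ 2 ∂(gaussianReal 0 1) = 1 := by
  have h := variance_id_gaussianReal (μ := 0) (v := 1)
  rw [variance_eq_integral measurable_id.aemeasurable] at h
  simpa using h

theorem integrable_energy_noise : Integrable energy (noise n) := by
  unfold energy noise
  refine integrable_finsetSum _ fun t _ => ?_
  exact integrable_comp_eval (μ := fun _ : Fin n => gaussianReal 0 1) (f := fun x : ℝ => x ^ 2)
    integrable_sq_gaussianReal

theorem integral_energy_noise : ∫ v, energy v ∂(noise n) = n := by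
  unfold energy noise
  rw [integral_finsetSum _ fun t _ =>
    integrable_comp_eval (μ := fun _ : Fin n => gaussianReal 0 1) (f := fun x : ℝ => x ^ 2)
      integrable_sq_gaussianReal]
  simp_rw [integral_comp_eval (μ := fun _ : Fin n => gaussianReal 0 1)
    (f := fun x : ℝ => x ^ 2) (by fun_prop), integral_sq_gaussianReal]
  simp

/-! ### Output of an additive Gaussian channel -/

/-- The law of the output of the channel `u ↦ u + noise` when the input has law `ν`. -/
def outLaw (ν : Measure (Fin n → ℝ)) : Measure (Fin n → ℝ) := ν ∗ noise n

/-- The Lebesgue density of `outLaw ν`. -/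
def outDensity (ν : Measure (Fin n → ℝ)) (y : Fin n → ℝ) : ℝ :=
  ∫ u, gaussianDensity 1 (y - u) ∂ν

/-- The differential entropy (in nats) of the channel output when the input has law `ν`. -/
def entropy (ν : Measure (Fin n → ℝ)) : ℝ := ∫ y, -Real.log (outDensity ν y) ∂(outLaw ν)

instance (ν : Measure (Fin n → ℝ)) [IsProbabilityMeasure ν] : IsProbabilityMeasure (outLaw ν) := by
  unfold outLaw; infer_instance

theorem gaussianDensity_one_le (v : Fin n → ℝ) :
    gaussianDensity 1 v ≤ Real.exp (-(n / 2 * Real.log (2 * Real.pi))) := by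
  unfold gaussianDensity
  rw [mul_one, mul_one]
  exact Real.exp_le_exp.2 (by linarith [energy_nonneg v])

theorem integrable_gaussianDensity_sub (ν : Measure (Fin n → ℝ)) [IsFiniteMeasure ν]
    (y : Fin n → ℝ) : Integrable (fun u => gaussianDensity 1 (y - u)) ν := by
  refine Integrable.of_bound (Measurable.aestronglyMeasurable (by fun_prop))
    (Real.exp (-(n / 2 * Real.log (2 * Real.pi)))) (ae_of_all _ fun u => ?_)
  rw [Real.norm_of_nonneg (gaussianDensity_pos _ _).le]
  exact gaussianDensity_one_le _

theorem ofReal_outDensity (ν : Measure (Fin n → ℝ)) [IsFiniteMeasure ν] (y : Fin n → ℝ) :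
    ENNReal.ofReal (outDensity ν y) = ∫⁻ u, ENNReal.ofReal (gaussianDensity 1 (y - u)) ∂ν :=
  ofReal_integral_eq_lintegral_ofReal (integrable_gaussianDensity_sub ν y)
    (ae_of_all _ fun _ => (gaussianDensity_pos _ _).le)

theorem outDensity_nonneg (ν : Measure (Fin n → ℝ)) (y : Fin n → ℝ) : 0 ≤ outDensity ν y :=
  integral_nonneg fun _ => (gaussianDensity_pos _ _).le

@[fun_prop]
theorem measurable_outDensity (ν : Measure (Fin n → ℝ)) [IsFiniteMeasure ν] :
    Measurable (outDensity ν) := by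
  have h : outDensity ν =
      fun y => (∫⁻ u, ENNReal.ofReal (gaussianDensity 1 (y - u)) ∂ν).toReal := by
    funext y
    rw [← ofReal_outDensity, ENNReal.toReal_ofReal (outDensity_nonneg ν y)]
  rw [h]
  refine Measurable.ennreal_toReal (Measurable.lintegral_prod_right'
    (f := fun p : (Fin n → ℝ) × (Fin n → ℝ) => ENNReal.ofReal (gaussianDensity 1 (p.1 - p.2))) ?_)
  fun_prop

theorem outDensity_le (ν : Measure (Fin n → ℝ)) [IsProbabilityMeasure ν] (y : Fin n → ℝ) :
    outDensity ν y ≤ Real.exp (-(n / 2 * Real.log (2 * Real.pi))) := by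
  have h := integral_mono (integrable_gaussianDensity_sub ν y) (integrable_const _)
    fun u => gaussianDensity_one_le (y - u)
  rw [integral_const, probReal_univ, one_smul] at h
  exact h

/-- The output density decays no faster than a Gaussian: `‖y - u‖² / 2 ≤ ‖y‖² + ‖u‖²`. -/
theorem exists_exp_le_outDensity (ν : Measure (Fin n → ℝ)) [IsProbabilityMeasure ν] :
    ∃ c : ℝ, ∀ y, Real.exp (c - energy y) ≤ outDensity ν y := by
  set K : ℝ := n / 2 * Real.log (2 * Real.pi)
  have hint : Integrable (fun u : Fin n → ℝ => Real.exp (-energy u - K)) ν := by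
    refine Integrable.of_bound (by fun_prop) (Real.exp (-K)) (ae_of_all _ fun u => ?_)
    rw [Real.norm_of_nonneg (Real.exp_pos _).le]
    exact Real.exp_le_exp.2 (by linarith [energy_nonneg u])
  have hpos : 0 < ∫ u, Real.exp (-energy u - K) ∂ν := integral_exp_pos hint
  refine ⟨Real.log (∫ u, Real.exp (-energy u - K) ∂ν), fun y => ?_⟩
  rw [Real.exp_sub, Real.exp_log hpos, div_eq_mul_inv, ← Real.exp_neg, ← integral_mul_const]
  refine integral_mono (hint.mul_const _) (integrable_gaussianDensity_sub ν y) fun u => ?_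
  simp only [gaussianDensity]
  rw [← Real.exp_add, mul_one, mul_one]
  change _ ≤ Real.exp (_ - K)
  exact Real.exp_le_exp.2 (by linarith [energy_sub_le y u])

theorem outDensity_pos (ν : Measure (Fin n → ℝ)) [IsProbabilityMeasure ν] (y : Fin n → ℝ) :
    0 < outDensity ν y := by
  obtain ⟨c, hc⟩ := exists_exp_le_outDensity ν
  exact (Real.exp_pos _).trans_le (hc y)

theorem log_outDensity_le (ν : Measure (Fin n → ℝ)) [IsProbabilityMeasure ν] (y : Fin n → ℝ) :
    Real.log (outDensity ν y) ≤ -(n / 2 * Real.log (2 * Real.pi)) := by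
  rw [← Real.log_exp (-(n / 2 * Real.log (2 * Real.pi)))]
  exact Real.log_le_log (outDensity_pos ν y) (outDensity_le ν y)

theorem integrable_log_outDensity {Ω : Type*} [MeasurableSpace Ω] {P : Measure Ω}
    [IsFiniteMeasure P] (ν : Measure (Fin n → ℝ)) [IsProbabilityMeasure ν] {Y : Ω → Fin n → ℝ}
    (hY : Measurable Y) (hint : Integrable (fun ω => energy (Y ω)) P) :
    Integrable (fun ω => Real.log (outDensity ν (Y ω))) P := by
  obtain ⟨c, hc⟩ := exists_exp_le_outDensity ν
  set K : ℝ := n / 2 * Real.log (2 * Real.pi)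
  refine Integrable.mono' (g := fun ω => |c| + |K| + energy (Y ω))
    ((integrable_const _).add hint) (Measurable.aestronglyMeasurable (by fun_prop))
    (ae_of_all _ fun ω => ?_)
  have h1 : _ ≤ -K := log_outDensity_le ν (Y ω)
  have h2 := Real.log_le_log (Real.exp_pos _) (hc (Y ω))
  rw [Real.log_exp] at h2
  rw [Real.norm_eq_abs, abs_le]
  constructor
  · linarith [neg_abs_le c, abs_nonneg K]
  · linarith [neg_abs_le K, abs_nonneg c, energy_nonneg (Y ω)]

theorem outLaw_eq_withDensity (ν : Measure (Fin n → ℝ)) [IsProbabilityMeasure ν] :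
    outLaw ν = volume.withDensity fun y => ENNReal.ofReal (outDensity ν y) := by
  refine Measure.ext_of_lintegral _ fun f hf => ?_
  rw [outLaw, Measure.lintegral_conv hf, lintegral_withDensity_eq_lintegral_mul _ (by fun_prop) hf]
  have h1 : ∀ u : Fin n → ℝ, ∫⁻ v, f (u + v) ∂(noise n) =
      ∫⁻ y, ENNReal.ofReal (gaussianDensity 1 (y - u)) * f y := by
    intro u
    rw [noise_eq_withDensity, lintegral_withDensity_eq_lintegral_mul _ (by fun_prop) (by fun_prop),
      ← lintegral_add_left_eq_self (fun y => ENNReal.ofReal (gaussianDensity 1 (y - u)) * f y) u]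
    simp
  simp_rw [h1]
  rw [lintegral_lintegral_swap (by fun_prop)]
  refine lintegral_congr fun y => ?_
  rw [Pi.mul_apply, ofReal_outDensity, lintegral_mul_const _ (by fun_prop)]

theorem integrable_energy_add {Ω : Type*} [MeasurableSpace Ω] {P : Measure Ω}
    {U V : Ω → Fin n → ℝ} (hU : Measurable U) (hV : Measurable V)
    (hu : Integrable (fun ω => energy (U ω)) P) (hv : Integrable (fun ω => energy (V ω)) P) :
    Integrable (fun ω => energy (U ω + V ω)) P := by
  refine Integrable.mono' ((hu.const_mul 2).add (hv.const_mul 2))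
    (Measurable.aestronglyMeasurable (by fun_prop)) (ae_of_all _ fun ω => ?_)
  rw [Real.norm_of_nonneg (energy_nonneg _)]
  exact energy_add_le _ _

theorem integrable_outLaw_iff (ν : Measure (Fin n → ℝ)) {f : (Fin n → ℝ) → ℝ} (hf : Measurable f) :
    Integrable f (outLaw ν) ↔
      Integrable (fun p : (Fin n → ℝ) × (Fin n → ℝ) => f (p.1 + p.2)) (ν.prod (noise n)) := by
  rw [outLaw, Measure.conv, integrable_map_measure hf.aestronglyMeasurable (by fun_prop)]
  rfl

theorem integral_outLaw (ν : Measure (Fin n → ℝ)) {f : (Fin n → ℝ) → ℝ} (hf : Measurable f) :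
    ∫ y, f y ∂(outLaw ν) = ∫ p, f (p.1 + p.2) ∂(ν.prod (noise n)) := by
  rw [outLaw, Measure.conv, integral_map (by fun_prop) hf.aestronglyMeasurable]

section Prob

variable (ν : Measure (Fin n → ℝ)) [IsProbabilityMeasure ν]

theorem integrable_energy_outLaw (hν : Integrable energy ν) : Integrable energy (outLaw ν) := by
  rw [integrable_outLaw_iff ν measurable_energy]
  exact integrable_energy_add measurable_fst measurable_snd (hν.comp_fst _)
    (integrable_energy_noise.comp_snd _)

theorem integral_energy_outLaw_le (hν : Integrable energy ν) :
    ∫ y, energy y ∂(outLaw ν) ≤ 2 * ∫ u, energy u ∂ν + 2 * n := by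
  rw [integral_outLaw ν measurable_energy]
  have h1 : Integrable (fun p : (Fin n → ℝ) × (Fin n → ℝ) => energy p.1) (ν.prod (noise n)) :=
    hν.comp_fst _
  have h2 : Integrable (fun p : (Fin n → ℝ) × (Fin n → ℝ) => energy p.2) (ν.prod (noise n)) :=
    integrable_energy_noise.comp_snd _
  have h := integral_mono (integrable_energy_add measurable_fst measurable_snd h1 h2)
    ((h1.const_mul 2).add (h2.const_mul 2)) fun p => energy_add_le p.1 p.2
  refine h.trans (le_of_eq ?_)
  simp only [Pi.add_apply]
  rw [integral_add (h1.const_mul 2) (h2.const_mul 2), integral_const_mul, integral_const_mul,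
    integral_fun_fst (μ := ν) (ν := noise n) (fun u => energy u),
    integral_fun_snd (μ := ν) (ν := noise n) (fun u => energy u), integral_energy_noise]
  simp

theorem lintegral_exp_sub_log_outDensity {q : (Fin n → ℝ) → ℝ} (hq : Measurable q) :
    ∫⁻ y, ENNReal.ofReal (Real.exp (q y - Real.log (outDensity ν y))) ∂(outLaw ν) =
      ∫⁻ y, ENNReal.ofReal (Real.exp (q y)) := by
  rw [outLaw_eq_withDensity, lintegral_withDensity_eq_lintegral_mul _ (by fun_prop) (by fun_prop)]
  refine lintegral_congr fun y => ?_
  rw [Pi.mul_apply, ← ENNReal.ofReal_mul (outDensity_nonneg ν y), Real.exp_sub,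
    Real.exp_log (outDensity_pos ν y), mul_div_cancel₀ _ (outDensity_pos ν y).ne']

/-- Gibbs' inequality for the channel output and an unnormalized test density `exp q`. -/
theorem entropy_add_integral_le (hν : Integrable energy ν) {q : (Fin n → ℝ) → ℝ}
    (hq : Measurable q) (hqi : Integrable q (outLaw ν)) {a : ℝ} (ha : 0 ≤ a)
    (h : ∫⁻ y, ENNReal.ofReal (Real.exp (q y)) ≤ ENNReal.ofReal a) :
    entropy ν + ∫ y, q y ∂(outLaw ν) ≤ a - 1 := by
  have hl := integrable_log_outDensity ν (P := outLaw ν) measurable_id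
    (integrable_energy_outLaw ν hν)
  have key := integral_le_of_lintegral_exp_le (P := outLaw ν) (hqi.sub hl) ha (by
    exact (lintegral_exp_sub_log_outDensity ν hq).trans_le h)
  simp only [Pi.sub_apply, id] at key hl
  rw [integral_sub hqi hl] at key
  rw [entropy, integral_neg]
  linarith

/-- A Gaussian test density bounds the entropy of a channel output by its energy. -/
theorem entropy_le (hν : Integrable energy ν) {s : ℝ} (hs : 0 < s) :
    entropy ν ≤ n / 2 * Real.log (2 * Real.pi * s) + (∫ u, energy u ∂ν + n) / s := by
  have he := integrable_energy_outLaw ν hν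
  have hi : Integrable (fun y : Fin n → ℝ => -(energy y / (2 * s)) -
      n / 2 * Real.log (2 * Real.pi * s)) (outLaw ν) :=
    (he.div_const _).neg.sub (integrable_const _)
  have key := entropy_add_integral_le ν hν (by fun_prop) hi zero_le_one (by
    rw [ENNReal.ofReal_one]
    exact (lintegral_gaussianDensity hs).le)
  rw [integral_sub (f := fun y : Fin n → ℝ => -(energy y / (2 * s))) (he.div_const _).neg
    (integrable_const _), integral_neg, integral_div] at key
  have h2 := integral_energy_outLaw_le ν hν
  have h3 : (∫ y, energy y ∂(outLaw ν)) / (2 * s) ≤ (∫ u, energy u ∂ν + n) / s := by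
    rw [div_le_div_iff₀ (by positivity) hs]
    nlinarith
  simp at key
  linarith

/-- The entropy of a channel output is nonnegative, as its density is below `1`. -/
theorem entropy_nonneg : 0 ≤ entropy ν := by
  refine integral_nonneg fun y => ?_
  have h1 := log_outDensity_le ν y
  have h2 : 0 ≤ Real.log (2 * Real.pi) := Real.log_nonneg (by linarith [Real.pi_gt_three])
  have h3 : (0 : ℝ) ≤ n / 2 * Real.log (2 * Real.pi) := by positivity
  simp only [Pi.zero_apply]
  linarith

end Prob

/-! ### Linear combinations of channel outputs -/

/-- The linear combination `∑ j, c j • u j` of the blocks `u j`. -/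
def lin {M : ℕ} (c : Fin M → ℝ) (u : Fin M → Fin n → ℝ) : Fin n → ℝ := fun t => ∑ j, c j * u j t

section lin

variable {M : ℕ} (c : Fin M → ℝ)

@[fun_prop]
theorem measurable_lin : Measurable (lin (n := n) c) := by unfold lin; fun_prop

theorem lin_add (u v : Fin M → Fin n → ℝ) : lin c (u + v) = lin c u + lin c v := by
  funext t
  simp [lin, mul_add, Finset.sum_add_distrib]

/-- The Cauchy-Schwarz inequality for the coefficient vector `(1, c)`. -/
theorem energy_add_lin_le (w : Fin n → ℝ) (v : Fin M → Fin n → ℝ) :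
    energy (w + lin c v) ≤ (1 + ∑ j, c j ^ 2) * (energy w + ∑ j, energy (v j)) := by
  simp only [energy]
  rw [Finset.sum_comm, ← Finset.sum_add_distrib, Finset.mul_sum]
  refine Finset.sum_le_sum fun t _ => ?_
  have hc := Finset.sum_mul_sq_le_sq_mul_sq Finset.univ c fun j => v j t
  simp only [Pi.add_apply, lin]
  set b := ∑ j, c j * v j t
  set S := ∑ j, c j ^ 2
  set V := ∑ j, v j t ^ 2
  have hS : 0 ≤ S := Finset.sum_nonneg fun _ _ => sq_nonneg _
  have hV : 0 ≤ V := Finset.sum_nonneg fun _ _ => sq_nonneg _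
  have h2 : 2 * (w t * b) ≤ V + S * w t ^ 2 := by
    refine abs_le_of_sq_le_sq' ?_ (by positivity) |>.2
    nlinarith [sq_nonneg (V - S * w t ^ 2), mul_le_mul_of_nonneg_left hc (sq_nonneg (w t))]
  nlinarith

end lin

theorem lintegral_outDensity (ν : Measure (Fin n → ℝ)) [IsProbabilityMeasure ν] :
    ∫⁻ y, ENNReal.ofReal (outDensity ν y) = 1 := by
  have h := congrArg (fun m => m Set.univ) (outLaw_eq_withDensity ν)
  simpa using h.symm

section combination

variable {M : ℕ} (c : Fin M → ℝ) (μ : Measure (Fin M → Fin n → ℝ)) [IsProbabilityMeasure μ]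

/-- The law of `(u, v, w)`, where `u` are the channel inputs of law `μ`, and `v` and `w` are
independent noises, meant to be added to the blocks of `u` and to a linear combination of them. -/
def noisyLaw : Measure ((Fin M → Fin n → ℝ) × ((Fin M → Fin n → ℝ) × (Fin n → ℝ))) :=
  μ.prod ((Measure.pi fun _ => noise n).prod (noise n))

instance : IsProbabilityMeasure (noisyLaw μ) := by unfold noisyLaw; infer_instance

theorem measurePreserving_block (j : Fin M) :
    MeasurePreserving (fun ω => ω.1 j + ω.2.1 j) (noisyLaw μ) (outLaw (μ.map fun u => u j)) := by
  have hA : MeasurePreserving (fun u : Fin M → Fin n → ℝ => u j) μ (μ.map fun u => u j) :=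
    ⟨by fun_prop, rfl⟩
  have hB := (measurePreserving_eval (fun _ : Fin M => noise n) j).comp
    (measurePreserving_fst (μ := Measure.pi fun _ : Fin M => noise n) (ν := noise n))
  have hadd : MeasurePreserving (fun p : (Fin n → ℝ) × (Fin n → ℝ) => p.1 + p.2)
      ((μ.map fun u => u j).prod (noise n)) (outLaw (μ.map fun u => u j)) := ⟨by fun_prop, rfl⟩
  exact hadd.comp (hA.prod hB)

theorem measurePreserving_lin_add :
    MeasurePreserving (fun ω => lin c ω.1 + ω.2.2) (noisyLaw μ) (outLaw (μ.map (lin c))) := by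
  have hA : MeasurePreserving (lin c) μ (μ.map (lin c)) := ⟨by fun_prop, rfl⟩
  have hB := measurePreserving_snd (μ := Measure.pi fun _ : Fin M => noise n) (ν := noise n)
  have hadd : MeasurePreserving (fun p : (Fin n → ℝ) × (Fin n → ℝ) => p.1 + p.2)
      ((μ.map (lin c)).prod (noise n)) (outLaw (μ.map (lin c))) := ⟨by fun_prop, rfl⟩
  exact hadd.comp (hA.prod hB)

theorem pi_noise_eq_withDensity :
    (Measure.pi fun _ : Fin M => noise n) =
      volume.withDensity fun v => ∏ j, ENNReal.ofReal (gaussianDensity 1 (v j)) := by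
  have : ∀ j : Fin M, SigmaFinite ((volume : Measure (Fin n → ℝ)).withDensity
      fun v => ENNReal.ofReal (gaussianDensity 1 v)) := fun j => by
    rw [← noise_eq_withDensity]; infer_instance
  simp_rw [noise_eq_withDensity]
  exact pi_withDensity volume (fun (_ : Fin M) (v : Fin n → ℝ) =>
    ENNReal.ofReal (gaussianDensity 1 v)) fun _ => by fun_prop

theorem pi_outLaw_eq_withDensity (ν : Fin M → Measure (Fin n → ℝ))
    [∀ j, IsProbabilityMeasure (ν j)] :
    (Measure.pi fun j => outLaw (ν j)) =
      volume.withDensity fun y => ∏ j, ENNReal.ofReal (outDensity (ν j) (y j)) := by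
  have : ∀ j : Fin M, SigmaFinite ((volume : Measure (Fin n → ℝ)).withDensity
      fun v => ENNReal.ofReal (outDensity (ν j) v)) := fun j => by
    rw [← outLaw_eq_withDensity]; infer_instance
  simp_rw [outLaw_eq_withDensity]
  exact pi_withDensity volume (fun (j : Fin M) (v : Fin n → ℝ) =>
    ENNReal.ofReal (outDensity (ν j) v)) fun _ => by fun_prop

/-- Conditionally on the inputs `u`, the test density for `(v, w)` is the product of the output
densities of the single blocks, reweighted so that the combination `lin c (u + v) + w` becomes
Gaussian around `lin c u`. It is normalized because `lin c y + w` has the density in the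
denominator when the blocks `y j` are independent. -/
theorem lintegral_exp_combination (ν : Fin M → Measure (Fin n → ℝ))
    [∀ j, IsProbabilityMeasure (ν j)] {s : ℝ} (hs : 0 < s) (u : Fin M → Fin n → ℝ) :
    ∫⁻ v, ∫⁻ w, ENNReal.ofReal (Real.exp (
        ∑ j, (Real.log (outDensity (ν j) (u j + v j)) - Real.log (gaussianDensity 1 (v j))) +
        Real.log (gaussianDensity s (w + lin c v)) -
        Real.log (outDensity ((Measure.pi fun j => outLaw (ν j)).map (lin c))
          (lin c (u + v) + w)))) ∂(noise n) ∂(Measure.pi fun _ : Fin M => noise n) = 1 := by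
  set σ := (Measure.pi fun j => outLaw (ν j)).map (lin c) with hσ
  have hσp : IsProbabilityMeasure σ := Measure.isProbabilityMeasure_map (by fun_prop)
  set G : (Fin n → ℝ) → ℝ≥0∞ := fun z => ENNReal.ofReal (Real.exp
    (Real.log (gaussianDensity s (z - lin c u)) - Real.log (outDensity σ z))) with hG
  have hGm : Measurable G := by fun_prop
  have hpt : ∀ v : Fin M → Fin n → ℝ, ∀ w : Fin n → ℝ, ENNReal.ofReal (Real.exp (
        ∑ j, (Real.log (outDensity (ν j) (u j + v j)) - Real.log (gaussianDensity 1 (v j))) +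
        Real.log (gaussianDensity s (w + lin c v)) -
        Real.log (outDensity σ (lin c (u + v) + w)))) =
      (∏ j, ENNReal.ofReal (gaussianDensity 1 (v j)))⁻¹ *
        ((∏ j, ENNReal.ofReal (outDensity (ν j) ((u + v) j))) * G (lin c (u + v) + w)) := by
    intro v w
    rw [add_sub_assoc, Real.exp_add, Real.exp_sum, hG]
    have h1 : lin c (u + v) + w - lin c u = w + lin c v := by rw [lin_add]; abel
    simp only [h1]
    rw [ENNReal.ofReal_mul (Finset.prod_nonneg fun _ _ => (Real.exp_pos _).le),
      ← mul_assoc]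
    congr 1
    rw [← ENNReal.ofReal_prod_of_nonneg fun _ _ => (gaussianDensity_pos _ _).le,
      ← ENNReal.ofReal_prod_of_nonneg fun _ _ => outDensity_nonneg _ _,
      ← ENNReal.ofReal_inv_of_pos (Finset.prod_pos fun _ _ => gaussianDensity_pos _ _),
      ← ENNReal.ofReal_mul (inv_nonneg.2 (Finset.prod_nonneg fun _ _ =>
        (gaussianDensity_pos _ _).le)), ← Finset.prod_inv_distrib, ← Finset.prod_mul_distrib]
    congr 1
    refine Finset.prod_congr rfl fun j _ => ?_
    rw [Real.exp_sub, Real.exp_log (outDensity_pos _ _), Real.exp_log (gaussianDensity_pos _ _),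
      div_eq_inv_mul, Pi.add_apply]
  simp_rw [hpt]
  rw [pi_noise_eq_withDensity, lintegral_withDensity_eq_lintegral_mul _ (by fun_prop) (by
    refine Measurable.lintegral_prod_right' (f := fun p : (Fin M → Fin n → ℝ) × (Fin n → ℝ) =>
      (∏ j, ENNReal.ofReal (gaussianDensity 1 (p.1 j)))⁻¹ *
        ((∏ j, ENNReal.ofReal (outDensity (ν j) ((u + p.1) j))) * G (lin c (u + p.1) + p.2))) ?_
    fun_prop)]
  have h2 : ∀ v : Fin M → Fin n → ℝ, ((fun v : Fin M → Fin n → ℝ =>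
        ∏ j, ENNReal.ofReal (gaussianDensity 1 (v j))) * fun v => ∫⁻ w,
        (∏ j, ENNReal.ofReal (gaussianDensity 1 (v j)))⁻¹ *
        ((∏ j, ENNReal.ofReal (outDensity (ν j) ((u + v) j))) * G (lin c (u + v) + w))
          ∂(noise n)) v =
      (fun y : Fin M → Fin n → ℝ => (∏ j, ENNReal.ofReal (outDensity (ν j) (y j))) *
        ∫⁻ w, G (lin c y + w) ∂(noise n)) (u + v) := by
    intro v
    rw [Pi.mul_apply, lintegral_const_mul _ (by fun_prop), ← mul_assoc,
      ENNReal.mul_inv_cancel, one_mul, lintegral_const_mul _ (by fun_prop)]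
    · rw [Finset.prod_ne_zero_iff]
      intro j _
      exact (ENNReal.ofReal_pos.2 (gaussianDensity_pos _ _)).ne'
    · exact ENNReal.prod_ne_top fun _ _ => ENNReal.ofReal_ne_top
  simp_rw [h2]
  rw [lintegral_add_left_eq_self (fun y : Fin M → Fin n → ℝ =>
    (∏ j, ENNReal.ofReal (outDensity (ν j) (y j))) * ∫⁻ w, G (lin c y + w) ∂(noise n)) u]
  have h3 : Measurable fun y : Fin M → Fin n → ℝ => ∫⁻ w, G (lin c y + w) ∂(noise n) :=
    Measurable.lintegral_prod_right'
      (f := fun p : (Fin M → Fin n → ℝ) × (Fin n → ℝ) => G (lin c p.1 + p.2)) (by fun_prop)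
  have h4 := lintegral_withDensity_eq_lintegral_mul (volume : Measure (Fin M → Fin n → ℝ))
    (f := fun y => ∏ j, ENNReal.ofReal (outDensity (ν j) (y j))) (by fun_prop) h3
  simp only [Pi.mul_apply] at h4
  rw [← h4, ← pi_outLaw_eq_withDensity]
  have h5 : Measurable fun x : Fin n → ℝ => ∫⁻ w, G (x + w) ∂(noise n) :=
    Measurable.lintegral_prod_right'
      (f := fun p : (Fin n → ℝ) × (Fin n → ℝ) => G (p.1 + p.2)) (by fun_prop)
  rw [← lintegral_map (g := lin c) h5 (by fun_prop), ← hσ, ← Measure.lintegral_conv hGm]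
  have h6 := lintegral_exp_sub_log_outDensity σ
    (q := fun z => Real.log (gaussianDensity s (z - lin c u))) (by fun_prop)
  rw [outLaw] at h6
  rw [hG, h6]
  simp_rw [Real.exp_log (gaussianDensity_pos _ _)]
  rw [lintegral_sub_right_eq_self (fun z => ENNReal.ofReal (gaussianDensity s z)),
    lintegral_gaussianDensity hs]

/-- For each value of `v`, the shift by `lin c v` of an output density is a normalized test density
for the output `lin c u + w`. -/
theorem lintegral_exp_shift (σ : Measure (Fin n → ℝ)) [IsProbabilityMeasure σ] :
    ∫⁻ ω, ENNReal.ofReal (Real.exp (Real.log (outDensity σ (lin c (ω.1 + ω.2.1) + ω.2.2)) -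
      Real.log (outDensity (μ.map (lin c)) (lin c ω.1 + ω.2.2)))) ∂(noisyLaw μ) = 1 := by
  have hp : IsProbabilityMeasure (μ.map (lin c)) :=
    Measure.isProbabilityMeasure_map (by fun_prop)
  rw [noisyLaw, lintegral_prod _ (Measurable.aemeasurable (by fun_prop))]
  have h1 : ∀ u : Fin M → Fin n → ℝ, ∫⁻ p : (Fin M → Fin n → ℝ) × (Fin n → ℝ),
      ENNReal.ofReal (Real.exp (Real.log (outDensity σ (lin c (u + p.1) + p.2)) -
      Real.log (outDensity (μ.map (lin c)) (lin c u + p.2))))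
        ∂((Measure.pi fun _ => noise n).prod (noise n)) =
      ∫⁻ v, ∫⁻ w, ENNReal.ofReal (Real.exp (Real.log (outDensity σ (lin c (u + v) + w)) -
      Real.log (outDensity (μ.map (lin c)) (lin c u + w)))) ∂(noise n)
        ∂(Measure.pi fun _ : Fin M => noise n) := fun u =>
    lintegral_prod _ (Measurable.aemeasurable (by fun_prop))
  simp_rw [h1]
  rw [lintegral_lintegral_swap (by
    refine Measurable.aemeasurable (Measurable.lintegral_prod_right'
      (f := fun q : ((Fin M → Fin n → ℝ) × (Fin M → Fin n → ℝ)) × (Fin n → ℝ) =>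
      ENNReal.ofReal (Real.exp (Real.log (outDensity σ (lin c (q.1.1 + q.1.2) + q.2)) -
      Real.log (outDensity (μ.map (lin c)) (lin c q.1.1 + q.2))))) ?_)
    fun_prop)]
  have h2 : ∀ v : Fin M → Fin n → ℝ, ∫⁻ u, ∫⁻ w, ENNReal.ofReal (Real.exp (Real.log (outDensity σ
      (lin c (u + v) + w)) - Real.log (outDensity (μ.map (lin c)) (lin c u + w))))
        ∂(noise n) ∂μ = 1 := by
    intro v
    set F : (Fin n → ℝ) → ℝ≥0∞ := fun z => ENNReal.ofReal (Real.exp (Real.log (outDensity σ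
      (z + lin c v)) - Real.log (outDensity (μ.map (lin c)) z))) with hF
    have hFm : Measurable F := by fun_prop
    have h3 : ∀ u w, ENNReal.ofReal (Real.exp (Real.log (outDensity σ
      (lin c (u + v) + w)) - Real.log (outDensity (μ.map (lin c)) (lin c u + w)))) =
        F (lin c u + w) := by
      intro u w
      rw [hF, lin_add, add_right_comm]
    simp_rw [h3]
    have h5 : Measurable fun x : Fin n → ℝ => ∫⁻ w, F (x + w) ∂(noise n) :=
      Measurable.lintegral_prod_right'
        (f := fun p : (Fin n → ℝ) × (Fin n → ℝ) => F (p.1 + p.2)) (by fun_prop)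
    rw [← lintegral_map (g := lin c) h5 (by fun_prop), ← Measure.lintegral_conv hFm]
    have h6 := lintegral_exp_sub_log_outDensity (μ.map (lin c))
      (q := fun z => Real.log (outDensity σ (z + lin c v))) (by fun_prop)
    rw [outLaw] at h6
    rw [hF, h6]
    simp_rw [Real.exp_log (outDensity_pos _ _)]
    rw [lintegral_add_right_eq_self (fun z => ENNReal.ofReal (outDensity σ z)),
      lintegral_outDensity]
  simp_rw [h2]
  simp

/-- The output entropy of a linear combination of (dependent) inputs is at most the sum of their
output entropies, up to a loss proportional to the block length. The joint output determines the
combination in additional noise `lin c v`, and this noise only increases entropy. -/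
theorem entropy_map_lin_le (hμ : ∀ j, Integrable (fun u => energy (u j)) μ) :
    entropy (μ.map (lin c)) ≤ ∑ j, entropy (μ.map fun u => u j) +
      n * (1 / 2 * Real.log (2 * Real.pi * (1 + ∑ j, c j ^ 2)) + 1 / 2) := by
  set ν : Fin M → Measure (Fin n → ℝ) := fun j => μ.map fun u => u j with hν
  have hνp : ∀ j, IsProbabilityMeasure (ν j) := fun j =>
    Measure.isProbabilityMeasure_map (measurable_pi_apply j).aemeasurable
  have hζp : IsProbabilityMeasure (μ.map (lin c)) :=
    Measure.isProbabilityMeasure_map (by fun_prop)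
  set σ := (Measure.pi fun j => outLaw (ν j)).map (lin c) with hσ
  have hσp : IsProbabilityMeasure σ := Measure.isProbabilityMeasure_map (by fun_prop)
  set s : ℝ := 1 + ∑ j, c j ^ 2 with hs
  have hs1 : 1 ≤ s := by
    have : 0 ≤ ∑ j, c j ^ 2 := Finset.sum_nonneg fun _ _ => sq_nonneg _
    linarith
  set P := noisyLaw μ with hP
  have eu : ∀ j, Integrable (fun ω => energy (ω.1 j)) P := fun j => (hμ j).comp_fst _
  have ev : ∀ j, Integrable (fun ω => energy (ω.2.1 j)) P := fun j =>
    Integrable.comp_snd (f := fun p : (Fin M → Fin n → ℝ) × (Fin n → ℝ) => energy (p.1 j))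
      (Integrable.comp_fst (f := fun p : Fin M → Fin n → ℝ => energy (p j))
      (integrable_comp_eval (μ := fun _ : Fin M => noise n) integrable_energy_noise) _) _
  have ew : Integrable (fun ω => energy ω.2.2) P :=
    Integrable.comp_snd (f := fun p : (Fin M → Fin n → ℝ) × (Fin n → ℝ) => energy p.2)
      (Integrable.comp_snd (f := fun p : Fin n → ℝ => energy p) integrable_energy_noise _) _
  have ewlin : ∀ {v : (Fin M → Fin n → ℝ) × ((Fin M → Fin n → ℝ) × (Fin n → ℝ)) →
      Fin M → Fin n → ℝ}, Measurable v → (∀ j, Integrable (fun ω => energy (v ω j)) P) →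
      Integrable (fun ω => energy (ω.2.2 + lin c (v ω))) P := by
    intro v hv hvi
    refine Integrable.mono' ((ew.add (integrable_finsetSum Finset.univ fun j _ => hvi j)).const_mul
      s) (Measurable.aestronglyMeasurable (by fun_prop)) (ae_of_all _ fun ω => ?_)
    rw [Real.norm_of_nonneg (energy_nonneg _)]
    exact energy_add_lin_le c _ _
  have euv : ∀ j, Integrable (fun ω => energy (ω.1 j + ω.2.1 j)) P := fun j =>
    integrable_energy_add (by fun_prop) (by fun_prop) (eu j) (ev j)
  have i1 : ∀ j, Integrable (fun ω => Real.log (outDensity (ν j) (ω.1 j + ω.2.1 j))) P :=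
    fun j => integrable_log_outDensity (ν j) (by fun_prop) (euv j)
  have i2 : Integrable (fun ω => Real.log (outDensity σ (lin c (ω.1 + ω.2.1) + ω.2.2))) P := by
    refine integrable_log_outDensity σ (by fun_prop) ?_
    simp_rw [add_comm (lin c _)]
    exact ewlin (by fun_prop) euv
  have i3 : Integrable (fun ω => Real.log (outDensity (μ.map (lin c)) (lin c ω.1 + ω.2.2))) P := by
    refine integrable_log_outDensity _ (by fun_prop) ?_
    simp_rw [add_comm (lin c _)]
    exact ewlin (by fun_prop) eu
  have i4 : ∀ j, Integrable (fun ω => Real.log (gaussianDensity 1 (ω.2.1 j))) P := by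
    intro j
    simp only [gaussianDensity, Real.log_exp]
    exact ((ev j).div_const _).neg.sub (integrable_const _)
  have i5 : Integrable (fun ω => Real.log (gaussianDensity s (ω.2.2 + lin c ω.2.1))) P := by
    simp only [gaussianDensity, Real.log_exp]
    exact ((ewlin (by fun_prop) ev).div_const _).neg.sub (integrable_const _)
  have i6 : ∀ j, Integrable (fun ω => Real.log (outDensity (ν j) (ω.1 j + ω.2.1 j)) -
      Real.log (gaussianDensity 1 (ω.2.1 j))) P := fun j => (i1 j).sub (i4 j)
  have i7 : Integrable (fun ω => ∑ j, (Real.log (outDensity (ν j) (ω.1 j + ω.2.1 j)) -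
      Real.log (gaussianDensity 1 (ω.2.1 j)))) P := integrable_finsetSum _ fun j _ => i6 j
  have i8 : Integrable (fun ω => ∑ j, (Real.log (outDensity (ν j) (ω.1 j + ω.2.1 j)) -
      Real.log (gaussianDensity 1 (ω.2.1 j))) +
      Real.log (gaussianDensity s (ω.2.2 + lin c ω.2.1))) P := i7.add i5
  -- `k1` compares the blocks with their noisy combination, `k2` removes the additional noise
  have k1 := integral_le_of_lintegral_exp_le (P := P)
    (f := fun ω => ∑ j, (Real.log (outDensity (ν j) (ω.1 j + ω.2.1 j)) -
        Real.log (gaussianDensity 1 (ω.2.1 j))) +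
        Real.log (gaussianDensity s (ω.2.2 + lin c ω.2.1)) -
        Real.log (outDensity σ (lin c (ω.1 + ω.2.1) + ω.2.2)))
    (i8.sub i2)
    zero_le_one (by
      rw [ENNReal.ofReal_one, hP, noisyLaw, lintegral_prod _ (Measurable.aemeasurable (by
        fun_prop))]
      have h1 : ∀ u : Fin M → Fin n → ℝ, _ = _ := fun u =>
        (lintegral_prod (μ := Measure.pi fun _ : Fin M => noise n) (ν := noise n)
          (fun p => ENNReal.ofReal (Real.exp (
            ∑ j, (Real.log (outDensity (ν j) (u j + p.1 j)) -
              Real.log (gaussianDensity 1 (p.1 j))) +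
            Real.log (gaussianDensity s (p.2 + lin c p.1)) -
            Real.log (outDensity σ (lin c (u + p.1) + p.2)))))
          (Measurable.aemeasurable (by fun_prop))).trans
        (lintegral_exp_combination c ν (zero_lt_one.trans_le hs1) u)
      simp_rw [h1]
      simp)
  have k2 := integral_le_of_lintegral_exp_le (P := P) (i2.sub i3) zero_le_one (by
      rw [ENNReal.ofReal_one]
      exact (lintegral_exp_shift c μ σ).le)
  rw [integral_sub i8 i2, integral_add i7 i5, integral_finsetSum _ fun j _ => i6 j] at k1
  simp only [Pi.sub_apply] at k2
  rw [integral_sub i2 i3] at k2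
  have e1 : ∀ j, ∫ ω, (Real.log (outDensity (ν j) (ω.1 j + ω.2.1 j)) -
        Real.log (gaussianDensity 1 (ω.2.1 j))) ∂P =
      -entropy (ν j) - ∫ ω, Real.log (gaussianDensity 1 (ω.2.1 j)) ∂P := by
    intro j
    rw [integral_sub (i1 j) (i4 j)]
    congr 1
    rw [entropy, integral_neg, neg_neg, ← (measurePreserving_block μ j).map_eq,
      integral_map (by fun_prop) (Measurable.aestronglyMeasurable (by fun_prop))]
  have e2 : ∫ ω, Real.log (outDensity (μ.map (lin c)) (lin c ω.1 + ω.2.2)) ∂P =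
      -entropy (μ.map (lin c)) := by
    rw [entropy, integral_neg, neg_neg, ← (measurePreserving_lin_add c μ).map_eq,
      integral_map (by fun_prop) (Measurable.aestronglyMeasurable (by fun_prop))]
  -- by Cauchy-Schwarz, the energies of the `v j` cancel, and only that of `w` remains
  have e3 : -(n / 2 * Real.log (2 * Real.pi * s)) - n / 2 ≤
      ∫ ω, (Real.log (gaussianDensity s (ω.2.2 + lin c ω.2.1)) -
        ∑ j, Real.log (gaussianDensity 1 (ω.2.1 j))) ∂P := by
    have hw : ∫ ω, energy ω.2.2 ∂P = n := by
      have hmp : MeasurePreserving (fun ω => ω.2.2) P (noise n) :=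
        (measurePreserving_snd (μ := Measure.pi fun _ : Fin M => noise n) (ν := noise n)).comp
        (measurePreserving_snd (μ := μ) (ν := (Measure.pi fun _ : Fin M => noise n).prod (noise n)))
      rw [← integral_energy_noise, ← hmp.map_eq, integral_map (by fun_prop)
        (Measurable.aestronglyMeasurable (by fun_prop))]
    calc -(n / 2 * Real.log (2 * Real.pi * s)) - n / 2
        = ∫ ω, (-(n / 2 * Real.log (2 * Real.pi * s)) - energy ω.2.2 / 2) ∂P := by
          rw [integral_sub (integrable_const _) (ew.div_const _), integral_div, hw]
          simp
      _ ≤ _ := by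
          refine integral_mono ((integrable_const _).sub (ew.div_const _))
            (i5.sub (integrable_finsetSum Finset.univ fun j _ => i4 j)) fun ω => ?_
          simp only [gaussianDensity, Real.log_exp]
          have hE := energy_add_lin_le c ω.2.2 ω.2.1
          have h2 : energy (ω.2.2 + lin c ω.2.1) / (2 * s) ≤
              (energy ω.2.2 + ∑ j, energy (ω.2.1 j)) / 2 := by
            rw [div_le_div_iff₀ (by positivity) two_pos]
            rw [← hs] at hE
            linarith
          have hK : 0 ≤ ∑ _j : Fin M, n / 2 * Real.log (2 * Real.pi * 1) := by
            refine Finset.sum_nonneg fun _ _ => mul_nonneg (by positivity) (Real.log_nonneg ?_)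
            linarith [Real.pi_gt_three]
          rw [Finset.sum_sub_distrib, Finset.sum_neg_distrib, ← Finset.sum_div, mul_one]
          linarith
  rw [integral_sub i5 (integrable_finsetSum Finset.univ fun j _ => i4 j),
    integral_finsetSum _ fun j _ => i4 j] at e3
  simp_rw [e1] at k1
  rw [Finset.sum_sub_distrib, Finset.sum_neg_distrib] at k1
  rw [e2] at k2
  linarith

end combination

/-! ### Uniform messages -/

section mixture

variable {α β : Type*} [MeasurableSpace α] [MeasurableSpace β] {N : ℕ}

/-- The equal-weight mixture of finitely many measures: the law of `x` when a uniform message `i` is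
drawn first, and then `x` according to `νs i`. -/
def mixture (νs : Fin N → Measure α) : Measure α := (N : ℝ≥0∞)⁻¹ • ∑ i, νs i

theorem lintegral_mixture (νs : Fin N → Measure α) (f : α → ℝ≥0∞) :
    ∫⁻ x, f x ∂(mixture νs) = (N : ℝ≥0∞)⁻¹ * ∑ i, ∫⁻ x, f x ∂(νs i) := by
  rw [mixture, lintegral_smul_measure, lintegral_finsetSum_measure, smul_eq_mul]

instance (νs : Fin N → Measure α) [NeZero N] [∀ i, IsProbabilityMeasure (νs i)] :
    IsProbabilityMeasure (mixture νs) := by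
  refine ⟨?_⟩
  have hN : (N : ℝ≥0∞) ≠ 0 := by exact_mod_cast NeZero.ne N
  have h := lintegral_mixture νs (fun _ => 1)
  simp only [lintegral_one, measure_univ] at h
  rw [h]
  simp [ENNReal.inv_mul_cancel hN (ENNReal.natCast_ne_top N)]

theorem integrable_mixture [NeZero N] {νs : Fin N → Measure α} {f : α → ℝ} :
    Integrable f (mixture νs) ↔ ∀ i, Integrable f (νs i) := by
  have hN : (N : ℝ≥0∞) ≠ 0 := by exact_mod_cast NeZero.ne N
  rw [mixture, integrable_smul_measure (ENNReal.inv_ne_zero.2 (ENNReal.natCast_ne_top N))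
    (ENNReal.inv_ne_top.2 hN), integrable_finsetSum_measure]
  simp

theorem integral_mixture {νs : Fin N → Measure α} {f : α → ℝ}
    (hf : ∀ i, Integrable f (νs i)) :
    ∫ x, f x ∂(mixture νs) = (N : ℝ)⁻¹ * ∑ i, ∫ x, f x ∂(νs i) := by
  rw [mixture, integral_smul_measure, integral_finsetSum_measure fun i _ => hf i]
  simp

theorem map_mixture (νs : Fin N → Measure α) {f : α → β} (hf : Measurable f) :
    (mixture νs).map f = mixture fun i => (νs i).map f := by
  refine Measure.ext_of_lintegral _ fun g hg => ?_
  simp_rw [lintegral_map hg hf, lintegral_mixture, lintegral_map hg hf]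

theorem mixture_comm {K : ℕ} (νs : Fin N → Fin K → Measure α) :
    mixture (fun i => mixture (νs i)) = mixture fun k => mixture fun i => νs i k := by
  refine Measure.ext_of_lintegral _ fun g hg => ?_
  simp_rw [lintegral_mixture, ← Finset.mul_sum]
  rw [Finset.sum_comm, ← mul_assoc, ← mul_assoc, mul_comm (N : ℝ≥0∞)⁻¹]

end mixture

theorem outLaw_mixture {N : ℕ} (νs : Fin N → Measure (Fin n → ℝ)) :
    outLaw (mixture νs) = mixture fun i => outLaw (νs i) := by
  refine Measure.ext_of_lintegral _ fun g hg => ?_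
  simp_rw [lintegral_mixture, outLaw, Measure.lintegral_conv hg, lintegral_mixture]

/-- The joint law of a uniform message and the channel output, when message `i` makes the input
law equal to `νs i`. -/
def jointLaw {N : ℕ} (νs : Fin N → Measure (Fin n → ℝ)) : Measure (Fin N × (Fin n → ℝ)) :=
  mixture fun i => (outLaw (νs i)).map (Prod.mk i)

section information

variable {N : ℕ} (νs : Fin N → Measure (Fin n → ℝ))

theorem jointLaw_map_snd : (jointLaw νs).map Prod.snd = outLaw (mixture νs) := by
  rw [jointLaw, map_mixture _ measurable_snd, outLaw_mixture]
  congr 1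
  funext i
  rw [Measure.map_map measurable_snd (by fun_prop)]
  exact Measure.map_id

variable [∀ i, IsProbabilityMeasure (νs i)]

instance [NeZero N] : IsProbabilityMeasure (jointLaw νs) := by
  have : ∀ i, IsProbabilityMeasure ((outLaw (νs i)).map (Prod.mk i)) := fun i =>
    Measure.isProbabilityMeasure_map (by fun_prop)
  unfold jointLaw; infer_instance

theorem jointLaw_map_fst :
    (jointLaw νs).map Prod.fst = mixture fun i => Measure.dirac i := by
  rw [jointLaw, map_mixture _ measurable_fst]
  congr 1
  funext i
  rw [Measure.map_map measurable_fst (by fun_prop)]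
  exact (Measure.map_const _ _).trans (by simp)

theorem jointLaw_real {S : Set (Fin N × (Fin n → ℝ))} (hS : MeasurableSet S) :
    (jointLaw νs).real S = (N : ℝ)⁻¹ * ∑ i, (outLaw (νs i)).real {y | (i, y) ∈ S} := by
  have h := lintegral_mixture (fun i => (outLaw (νs i)).map (Prod.mk i)) (S.indicator 1)
  simp_rw [lintegral_indicator_one hS] at h
  rw [measureReal_def, jointLaw, h, ENNReal.toReal_mul, ENNReal.toReal_sum fun i _ => by
    rw [Measure.map_apply (by fun_prop) hS]; exact measure_ne_top _ _]
  simp only [ENNReal.toReal_inv, ENNReal.toReal_natCast]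
  congr 1
  refine Finset.sum_congr rfl fun i _ => ?_
  rw [Measure.map_apply (by fun_prop) hS]
  rfl

variable [NeZero N]

theorem integrable_log_mixture (hν : ∀ i, Integrable energy (νs i)) (i : Fin N) :
    Integrable (fun y => Real.log (outDensity (mixture νs) y)) (outLaw (νs i)) :=
  integrable_log_outDensity _ measurable_id (integrable_energy_outLaw _ (hν i))

theorem entropy_mixture (hν : ∀ i, Integrable energy (νs i)) : entropy (mixture νs) =
    -((N : ℝ)⁻¹ * ∑ i, ∫ y, Real.log (outDensity (mixture νs) y) ∂(outLaw (νs i))) := by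
  rw [entropy, integral_neg]
  conv_lhs => rw [outLaw_mixture]
  rw [integral_mixture (integrable_log_mixture νs hν)]

/-- Fano's inequality: a decoder recovering the message from the channel output with small error
probability forces the output entropy to drop by nearly `log N` when the message is given. -/
theorem fano (hν : ∀ i, Integrable energy (νs i)) {dec : (Fin n → ℝ) → Fin N} (hdec : Measurable dec) :
    (1 - (jointLaw νs).real {p | dec p.2 ≠ p.1}) * Real.log N - Real.log 2 ≤
      entropy (mixture νs) - (N : ℝ)⁻¹ * ∑ i, entropy (νs i) := by
  have hN : (0 : ℝ) < N := by exact_mod_cast NeZero.pos N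
  have hset : ∀ i, MeasurableSet {y | dec y = i} := fun i => hdec (measurableSet_singleton i)
  set p := outDensity (mixture νs) with hp
  -- the test density favours, by the factor `N`, the outputs that are decoded to `i`
  set q : Fin N → (Fin n → ℝ) → ℝ := fun i y =>
    Real.log (p y) + {y | dec y = i}.indicator (fun _ => Real.log N) y - Real.log 2 with hq
  have hind : ∀ i (μ : Measure (Fin n → ℝ)) [IsProbabilityMeasure μ] (r : ℝ),
      Integrable ({y | dec y = i}.indicator fun _ => r) μ := fun i μ _ r =>
    (integrable_const r).indicator (hset i)
  have hind' : ∀ i (μ : Measure (Fin n → ℝ)) [IsProbabilityMeasure μ] (r : ℝ),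
      ∫ y, {y | dec y = i}.indicator (fun _ => r) y ∂μ = μ.real {y | dec y = i} * r :=
    fun i μ _ r => by rw [integral_indicator (hset i)]; simp
  have hindm : ∀ i (r : ℝ), Measurable ({y | dec y = i}.indicator fun _ => r) := fun i r =>
    measurable_const.indicator (hset i)
  have hqm : ∀ i, Measurable (q i) := fun i => by
    have := hindm i (Real.log N)
    fun_prop
  have hqi : ∀ i, Integrable (q i) (outLaw (νs i)) := fun i =>
    ((integrable_log_mixture νs hν i).add (hind i _ _)).sub (integrable_const _)
  have key : ∀ i, entropy (νs i) + ∫ y, q i y ∂(outLaw (νs i)) ≤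
      (1 + (outLaw (mixture νs)).real {y | dec y = i} * N) / 2 - 1 := by
    intro i
    refine entropy_add_integral_le (νs i) (hν i) (hqm i) (hqi i) (by positivity) ?_
    have h1 : ∀ y, ENNReal.ofReal (Real.exp (q i y)) ≤ ENNReal.ofReal (p y) *
        ENNReal.ofReal ((1 + {y | dec y = i}.indicator (fun _ => (N : ℝ)) y) / 2) := by
      intro y
      rw [← ENNReal.ofReal_mul (outDensity_nonneg _ _)]
      refine ENNReal.ofReal_le_ofReal ?_
      have hpos := outDensity_pos (mixture νs) y
      rw [hq, Real.exp_sub, Real.exp_add, Real.exp_log hpos, Real.exp_log two_pos, mul_div_assoc]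
      refine mul_le_mul_of_nonneg_left ?_ hpos.le
      by_cases hy : dec y = i
      · simp [hy, Real.exp_log hN]
        linarith
      · simp [hy]
    have h2 : Measurable fun y => (1 + {y | dec y = i}.indicator (fun _ => (N : ℝ)) y) / 2 := by
      have := hindm i N
      fun_prop
    refine (lintegral_mono h1).trans (le_of_eq ?_)
    have h3 := lintegral_withDensity_eq_lintegral_mul volume
      (f := fun y => ENNReal.ofReal (p y)) (by fun_prop) h2.ennreal_ofReal
    simp only [Pi.mul_apply] at h3
    rw [← h3, hp, ← outLaw_eq_withDensity, ← ofReal_integral_eq_lintegral_ofReal]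
    · rw [integral_div, integral_add (integrable_const _) (hind i _ _), hind']
      simp
    · exact ((integrable_const _).add (hind i _ _)).div_const _
    · refine ae_of_all _ fun y => ?_
      have : 0 ≤ {y | dec y = i}.indicator (fun _ => (N : ℝ)) y :=
        Set.indicator_nonneg (fun _ _ => hN.le) y
      simp only [Pi.zero_apply]
      positivity
  have hint : ∀ i, ∫ y, q i y ∂(outLaw (νs i)) = ∫ y, Real.log (p y) ∂(outLaw (νs i)) +
      (outLaw (νs i)).real {y | dec y = i} * Real.log N - Real.log 2 := by
    intro i
    have h1 : Integrable (fun y => Real.log (p y) +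
        {y | dec y = i}.indicator (fun _ => Real.log N) y) (outLaw (νs i)) :=
      (integrable_log_mixture νs hν i).add (hind i _ _)
    simp only [hq]
    rw [integral_sub h1 (integrable_const _),
      integral_add (integrable_log_mixture νs hν i) (hind i _ _), hind']
    simp [hp]
  have hpart : ∑ i, (outLaw (mixture νs)).real {y | dec y = i} = 1 := by
    have h := sum_measureReal_preimage_singleton (μ := outLaw (mixture νs)) (f := dec)
      Finset.univ (fun i _ => hdec (measurableSet_singleton i))
    simp only [Finset.coe_univ, Set.preimage_univ, probReal_univ] at h
    exact h
  have herr : (jointLaw νs).real {p | dec p.2 ≠ p.1} =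
      1 - (N : ℝ)⁻¹ * ∑ i, (outLaw (νs i)).real {y | dec y = i} := by
    have hS : MeasurableSet {p : Fin N × (Fin n → ℝ) | dec p.2 ≠ p.1} :=
      (measurableSet_eq_fun (hdec.comp measurable_snd) measurable_fst).compl
    rw [jointLaw_real νs hS]
    have h1 : ∀ i, (outLaw (νs i)).real {y | (i, y) ∈ {p : Fin N × (Fin n → ℝ) | dec p.2 ≠ p.1}} =
        1 - (outLaw (νs i)).real {y | dec y = i} := fun i => by
      rw [← probReal_compl_eq_one_sub (hset i)]
      rfl
    simp_rw [h1, Finset.sum_sub_distrib, mul_sub]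
    simp [hN.ne']
  have hsum := Finset.sum_le_sum fun i (_ : i ∈ Finset.univ) => key i
  simp_rw [hint, Finset.sum_add_distrib, Finset.sum_sub_distrib, Finset.sum_add_distrib,
    ← Finset.sum_div, Finset.sum_add_distrib, ← Finset.sum_mul, hpart] at hsum
  rw [herr, entropy_mixture νs hν]
  simp only [Finset.sum_const, Finset.card_univ, Fintype.card_fin, nsmul_eq_mul, mul_one,
    one_mul] at hsum
  have h4 := mul_le_mul_of_nonneg_left hsum (inv_nonneg.2 hN.le)
  have h5 : (N : ℝ)⁻¹ * N = 1 := inv_mul_cancel₀ hN.ne'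
  have h6 : (N : ℝ)⁻¹ * ((N + N) / 2 - N) = 0 := by ring
  rw [h6] at h4
  have h7 : (N : ℝ)⁻¹ * (∑ i, entropy (νs i) + (∑ i, ∫ y, Real.log (p y) ∂(outLaw (νs i)) +
      (∑ i, (outLaw (νs i)).real {y | dec y = i}) * Real.log N - N * Real.log 2)) =
      (N : ℝ)⁻¹ * ∑ i, entropy (νs i) + (N : ℝ)⁻¹ * ∑ i, ∫ y, Real.log (p y) ∂(outLaw (νs i)) +
      (N : ℝ)⁻¹ * (∑ i, (outLaw (νs i)).real {y | dec y = i}) * Real.log N -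
      (N : ℝ)⁻¹ * N * Real.log 2 := by ring
  rw [h7, h5] at h4
  linarith

/-- The information leaked by the channel output about the message bounds the drop of the output
entropy when the message is given. -/
theorem entropy_sub_le_klDiv (hν : ∀ i, Integrable energy (νs i)) :
    ENNReal.ofReal (entropy (mixture νs) - (N : ℝ)⁻¹ * ∑ i, entropy (νs i)) ≤
      InformationTheory.klDiv (jointLaw νs)
        (((jointLaw νs).map Prod.fst).prod ((jointLaw νs).map Prod.snd)) := by
  rw [jointLaw_map_fst, jointLaw_map_snd]
  set p := outDensity (mixture νs) with hp
  set f : Fin N × (Fin n → ℝ) → ℝ := fun x =>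
    Real.log (outDensity (νs x.1) x.2) - Real.log (p x.2) with hf
  have hfm : Measurable f := measurable_from_prod_countable_right fun i => by
    simp only [hf]; fun_prop
  have h0 : ∀ i, Integrable (fun y => Real.log (outDensity (νs i) y)) (outLaw (νs i)) := fun i =>
    integrable_log_outDensity _ measurable_id (integrable_energy_outLaw _ (hν i))
  have hi : ∀ i, Integrable f ((outLaw (νs i)).map (Prod.mk i)) := fun i => by
    rw [integrable_map_measure hfm.aestronglyMeasurable (by fun_prop)]
    exact (h0 i).sub (integrable_log_mixture νs hν i)
  have hval : ∫ x, f x ∂(jointLaw νs) =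
      entropy (mixture νs) - (N : ℝ)⁻¹ * ∑ i, entropy (νs i) := by
    rw [jointLaw, integral_mixture hi, entropy_mixture νs hν]
    have h1 : ∀ i, ∫ x, f x ∂((outLaw (νs i)).map (Prod.mk i)) =
        -entropy (νs i) - ∫ y, Real.log (p y) ∂(outLaw (νs i)) := by
      intro i
      rw [integral_map (by fun_prop) hfm.aestronglyMeasurable, entropy, integral_neg, neg_neg,
        ← integral_sub (h0 i) (integrable_log_mixture νs hν i)]
    simp_rw [h1, Finset.sum_sub_distrib, Finset.sum_neg_distrib]
    ring
  rw [← hval]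
  refine ofReal_integral_le_klDiv hfm (integrable_mixture.2 hi) ?_
  rw [lintegral_prod _ (Measurable.aemeasurable (by fun_prop)), lintegral_mixture]
  simp_rw [lintegral_dirac]
  have h2 : ∀ i, ∫⁻ y, ENNReal.ofReal (Real.exp (f (i, y))) ∂(outLaw (mixture νs)) = 1 := by
    intro i
    rw [lintegral_exp_sub_log_outDensity (mixture νs) (q := fun y => Real.log (outDensity (νs i) y))
      (by fun_prop)]
    simp_rw [Real.exp_log (outDensity_pos _ _)]
    exact lintegral_outDensity _
  simp_rw [h2]
  have hN : (N : ℝ≥0∞) ≠ 0 := by exact_mod_cast NeZero.ne N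
  simp [ENNReal.inv_mul_cancel hN (ENNReal.natCast_ne_top N)]

end information

/-! ### Receivers of a multi-antenna transmitter -/

variable {M : ℕ}

/-- The noiseless signal seen by a receiver with channel vector `a`. -/
def proj (a : EuclideanSpace ℝ (Fin M)) (x : Fin n → EuclideanSpace ℝ (Fin M)) : Fin n → ℝ :=
  fun t => inner ℝ a (x t)

/-- The total energy `∑ₜ ‖x(t)‖²` of an input sequence. -/
def inputEnergy (x : Fin n → EuclideanSpace ℝ (Fin M)) : ℝ := ∑ t, ‖x t‖ ^ 2

@[fun_prop]
theorem measurable_proj (a : EuclideanSpace ℝ (Fin M)) : Measurable (proj (n := n) a) := by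
  unfold proj
  exact measurable_pi_lambda _ fun t => (measurable_pi_apply t).const_inner

@[fun_prop]
theorem measurable_inputEnergy : Measurable (inputEnergy (n := n) (M := M)) := by
  unfold inputEnergy; fun_prop

theorem inputEnergy_nonneg (x : Fin n → EuclideanSpace ℝ (Fin M)) : 0 ≤ inputEnergy x :=
  Finset.sum_nonneg fun _ _ => sq_nonneg _

theorem energy_proj_le (a : EuclideanSpace ℝ (Fin M)) (x : Fin n → EuclideanSpace ℝ (Fin M)) :
    energy (proj a x) ≤ ‖a‖ ^ 2 * inputEnergy x := by
  unfold energy inputEnergy proj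
  rw [Finset.mul_sum]
  refine Finset.sum_le_sum fun t _ => ?_
  rw [← mul_pow, ← sq_abs]
  exact pow_le_pow_left₀ (abs_nonneg _) (abs_real_inner_le_norm _ _) 2

/-- The entropy of the signal received through the channel vector `a`, for an input law `μ`. -/
def recvEntropy (μ : Measure (Fin n → EuclideanSpace ℝ (Fin M))) (a : EuclideanSpace ℝ (Fin M)) :
    ℝ := entropy (μ.map (proj a))

section receiver

variable (μ : Measure (Fin n → EuclideanSpace ℝ (Fin M)))

theorem integrable_energy_map_proj (hμ : Integrable inputEnergy μ)
    (a : EuclideanSpace ℝ (Fin M)) : Integrable energy (μ.map (proj a)) := by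
  rw [integrable_map_measure measurable_energy.aestronglyMeasurable (by fun_prop)]
  refine Integrable.mono' (hμ.const_mul (‖a‖ ^ 2)) (Measurable.aestronglyMeasurable (by fun_prop))
    (ae_of_all _ fun x => ?_)
  rw [Function.comp_apply, Real.norm_of_nonneg (energy_nonneg _)]
  exact energy_proj_le a x

variable [IsProbabilityMeasure μ]

instance (a : EuclideanSpace ℝ (Fin M)) : IsProbabilityMeasure (μ.map (proj a)) :=
  Measure.isProbabilityMeasure_map (by fun_prop)

theorem recvEntropy_nonneg (a : EuclideanSpace ℝ (Fin M)) : 0 ≤ recvEntropy μ a :=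
  entropy_nonneg _

/-- The capacity bound of a single receiver, up to a constant per channel use that does not depend
on the power. -/
theorem recvEntropy_le (hμ : Integrable inputEnergy μ) {P : ℝ} (hP : 0 < P)
    (h : ∫ x, inputEnergy x ∂μ ≤ n * P) (a : EuclideanSpace ℝ (Fin M)) :
    recvEntropy μ a ≤
      n * (1 / 2 * Real.log (1 + P) + (1 / 2 * Real.log (2 * Real.pi) + ‖a‖ ^ 2 + 1)) := by
  have hi := integrable_energy_map_proj μ hμ a
  have hE : ∫ u, energy u ∂(μ.map (proj a)) ≤ ‖a‖ ^ 2 * (n * P) := by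
    rw [integral_map (by fun_prop) measurable_energy.aestronglyMeasurable]
    refine le_trans ?_ (mul_le_mul_of_nonneg_left h (sq_nonneg _))
    rw [← integral_const_mul]
    refine integral_mono ?_ (hμ.const_mul _) fun x => energy_proj_le a x
    exact (integrable_map_measure measurable_energy.aestronglyMeasurable (by fun_prop)).1 hi
  have h1 := entropy_le (μ.map (proj a)) hi (s := 1 + P) (by linarith)
  have h2 : (∫ u, energy u ∂(μ.map (proj a)) + n) / (1 + P) ≤ n * (‖a‖ ^ 2 + 1) := by
    rw [div_le_iff₀ (by linarith)]
    have h3 : (0 : ℝ) ≤ n * ‖a‖ ^ 2 := by positivity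
    have h4 : (0 : ℝ) ≤ n * P := by positivity
    nlinarith
  rw [Real.log_mul (by positivity) (by linarith)] at h1
  unfold recvEntropy
  linarith

/-- If `b` is a combination of the channel vectors `a j`, then the receivers `a j` together see
almost all that the receiver `b` sees. -/
theorem recvEntropy_sum_le (hμ : Integrable inputEnergy μ) {m : ℕ}
    (a : Fin m → EuclideanSpace ℝ (Fin M)) (c : Fin m → ℝ) :
    recvEntropy μ (∑ j, c j • a j) ≤ ∑ j, recvEntropy μ (a j) +
      n * (1 / 2 * Real.log (2 * Real.pi * (1 + ∑ j, c j ^ 2)) + 1 / 2) := by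
  have hm : Measurable fun (x : Fin n → EuclideanSpace ℝ (Fin M)) (j : Fin m) => proj (a j) x :=
    measurable_pi_lambda _ fun j => measurable_proj (a j)
  have hp : IsProbabilityMeasure (μ.map fun x j => proj (a j) x) :=
    Measure.isProbabilityMeasure_map hm.aemeasurable
  have hmap : ∀ j, (μ.map fun x j => proj (a j) x).map (fun u => u j) = μ.map (proj (a j)) := by
    intro j
    rw [Measure.map_map (measurable_pi_apply j) hm]
    rfl
  have hlin : (μ.map fun x j => proj (a j) x).map (lin c) = μ.map (proj (∑ j, c j • a j)) := by
    rw [Measure.map_map (measurable_lin c) hm]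
    congr 1
    funext x t
    simp [lin, proj, sum_inner, inner_smul_left]
  have h := entropy_map_lin_le c (μ.map fun x j => proj (a j) x) fun j => by
    have h1 := integrable_energy_map_proj μ hμ (a j)
    rw [← hmap j] at h1
    exact (integrable_map_measure measurable_energy.aestronglyMeasurable
      (measurable_pi_apply j).aemeasurable).1 h1
  simp_rw [hmap, hlin] at h
  exact h

end receiver

/-! ### Codes -/

theorem uniformOn_univ_eq_mixture {N : ℕ} :
    uniformOn (Set.univ : Set (Fin N)) = mixture fun i => Measure.dirac i := by
  refine Measure.ext_of_lintegral _ fun f hf => ?_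
  rw [lintegral_mixture, uniformOn, ProbabilityTheory.cond, lintegral_smul_measure,
    Measure.restrict_univ, lintegral_count, tsum_fintype, Measure.count_univ]
  simp

namespace Code

variable {J₁ J₂ : ℕ} (c : Code M J₁ J₂ n)

instance : NeZero c.N₁ := ⟨c.N₁_pos.ne'⟩

instance : NeZero c.N₂ := ⟨c.N₂_pos.ne'⟩

instance : IsMarkovKernel c.encoder := c.isMarkovKernel_encoder

/-- The law of the input sequence given the first message. -/
def input₁ (i : Fin c.N₁) : Measure (Fin n → EuclideanSpace ℝ (Fin M)) :=
  mixture fun b => c.encoder (i, b)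

/-- The law of the input sequence given the second message. -/
def input₂ (b : Fin c.N₂) : Measure (Fin n → EuclideanSpace ℝ (Fin M)) :=
  mixture fun i => c.encoder (i, b)

/-- The law of the input sequence. -/
def input : Measure (Fin n → EuclideanSpace ℝ (Fin M)) := mixture c.input₁

instance (i : Fin c.N₁) : IsProbabilityMeasure (c.input₁ i) := by unfold input₁; infer_instance

instance (b : Fin c.N₂) : IsProbabilityMeasure (c.input₂ b) := by unfold input₂; infer_instance

instance : IsProbabilityMeasure c.input := by unfold input; infer_instance

theorem input_eq_mixture_input₂ : c.input = mixture c.input₂ := mixture_comm _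

theorem lintegral_inputLaw
    {F : (Fin c.N₁ × Fin c.N₂) × (Fin n → EuclideanSpace ℝ (Fin M)) → ℝ≥0∞} (hF : Measurable F) :
    ∫⁻ p, F p ∂c.inputLaw = (c.N₁ : ℝ≥0∞)⁻¹ * ∑ i, ((c.N₂ : ℝ≥0∞)⁻¹ *
      ∑ b, ∫⁻ x, F ((i, b), x) ∂(c.encoder (i, b))) := by
  rw [inputLaw, Measure.lintegral_compProd hF, lintegral_prod _ Measurable.of_discrete.aemeasurable,
    uniformOn_univ_eq_mixture, uniformOn_univ_eq_mixture, lintegral_mixture]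
  simp_rw [lintegral_dirac, lintegral_mixture, lintegral_dirac]

theorem lintegral_inputLaw_snd {F : (Fin n → EuclideanSpace ℝ (Fin M)) → ℝ≥0∞}
    (hF : Measurable F) : ∫⁻ p, F p.2 ∂c.inputLaw = ∫⁻ x, F x ∂c.input := by
  rw [c.lintegral_inputLaw (F := fun p => F p.2) (by fun_prop), input, lintegral_mixture]
  simp_rw [input₁, lintegral_mixture]

instance : IsProbabilityMeasure c.inputLaw := by unfold inputLaw; infer_instance

instance : IsProbabilityMeasure c.law := by unfold law; infer_instance

theorem lintegral_law (r : Fin J₁ ⊕ Fin J₂) (a : EuclideanSpace ℝ (Fin M))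
    {F : (Fin c.N₁ × Fin c.N₂) × (Fin n → ℝ) → ℝ≥0∞} (hF : Measurable F) :
    ∫⁻ ω, F (ω.1.1, proj a ω.1.2 + ω.2 r) ∂c.law =
      (c.N₁ : ℝ≥0∞)⁻¹ * ∑ i, ((c.N₂ : ℝ≥0∞)⁻¹ *
        ∑ b, ∫⁻ y, F ((i, b), y) ∂(outLaw ((c.encoder (i, b)).map (proj a)))) := by
  have hmp : MeasurePreserving (fun v : Fin J₁ ⊕ Fin J₂ → Fin n → ℝ => v r)
      (Measure.pi fun _ => Measure.pi fun _ => gaussianReal 0 1) (noise n) :=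
    measurePreserving_eval (fun _ : Fin J₁ ⊕ Fin J₂ => noise n) r
  have h1 : ∀ p : (Fin c.N₁ × Fin c.N₂) × (Fin n → EuclideanSpace ℝ (Fin M)),
      ∫⁻ v, F (p.1, proj a p.2 + v r) ∂(Measure.pi fun _ : Fin J₁ ⊕ Fin J₂ =>
        Measure.pi fun _ : Fin n => gaussianReal 0 1) =
      ∫⁻ v, F (p.1, proj a p.2 + v) ∂(noise n) := fun p =>
    hmp.lintegral_comp (f := fun v => F (p.1, proj a p.2 + v)) (by fun_prop)
  have hFm : Measurable fun p : (Fin c.N₁ × Fin c.N₂) × (Fin n → EuclideanSpace ℝ (Fin M)) =>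
      ∫⁻ v, F (p.1, proj a p.2 + v) ∂(noise n) :=
    Measurable.lintegral_prod_right'
      (f := fun q : ((Fin c.N₁ × Fin c.N₂) × (Fin n → EuclideanSpace ℝ (Fin M))) × (Fin n → ℝ) =>
        F (q.1.1, proj a q.1.2 + q.2)) (by fun_prop)
  rw [law, lintegral_prod _ (Measurable.aemeasurable (by fun_prop))]
  simp_rw [h1]
  rw [c.lintegral_inputLaw hFm]
  congr 2
  funext i
  congr 2
  funext b
  have hG : Measurable fun y => F ((i, b), y) := by fun_prop
  have hG2 : Measurable fun u : Fin n → ℝ => ∫⁻ v, F ((i, b), u + v) ∂(noise n) :=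
    Measurable.lintegral_prod_right'
      (f := fun q : (Fin n → ℝ) × (Fin n → ℝ) => F ((i, b), q.1 + q.2)) (by fun_prop)
  rw [outLaw, Measure.lintegral_conv hG, lintegral_map hG2 (by fun_prop)]

theorem map_law_msg₁ (r : Fin J₁ ⊕ Fin J₂) (a : EuclideanSpace ℝ (Fin M)) :
    c.law.map (fun ω => (c.msg₁ ω, proj a ω.1.2 + ω.2 r)) =
      jointLaw fun i => (c.input₁ i).map (proj a) := by
  refine Measure.ext_of_lintegral _ fun F hF => ?_
  have hm : Measurable fun ω : c.Sample => (c.msg₁ ω, proj a ω.1.2 + ω.2 r) := by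
    unfold msg₁; fun_prop
  rw [lintegral_map hF hm, jointLaw, lintegral_mixture]
  refine (c.lintegral_law r a (F := fun p => F (p.1.1, p.2)) (by fun_prop)).trans ?_
  congr 2
  funext i
  rw [lintegral_map hF (by fun_prop), input₁, map_mixture _ (measurable_proj a), outLaw_mixture,
    lintegral_mixture]

theorem map_law_msg₂ (r : Fin J₁ ⊕ Fin J₂) (a : EuclideanSpace ℝ (Fin M)) :
    c.law.map (fun ω => (c.msg₂ ω, proj a ω.1.2 + ω.2 r)) =
      jointLaw fun b => (c.input₂ b).map (proj a) := by
  refine Measure.ext_of_lintegral _ fun F hF => ?_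
  have hm : Measurable fun ω : c.Sample => (c.msg₂ ω, proj a ω.1.2 + ω.2 r) := by
    unfold msg₂; fun_prop
  rw [lintegral_map hF hm, jointLaw, lintegral_mixture]
  refine (c.lintegral_law r a (F := fun p => F (p.1.2, p.2)) (by fun_prop)).trans ?_
  rw [← Finset.mul_sum, mul_left_comm, Finset.sum_comm, Finset.mul_sum]
  congr 2
  funext b
  rw [lintegral_map hF (by fun_prop), input₂, map_mixture _ (measurable_proj a), outLaw_mixture,
    lintegral_mixture]

theorem integrable_inputEnergy {P : ℝ} (hc : c.SatisfiesPower P) :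
    Integrable inputEnergy c.input ∧ (0 ≤ P → ∫ x, inputEnergy x ∂c.input ≤ n * P) := by
  have h1 : ∫⁻ x, ENNReal.ofReal (inputEnergy x) ∂c.input ≤ ENNReal.ofReal (n * P) := by
    refine le_trans (le_of_eq ?_) hc
    rw [← c.lintegral_inputLaw_snd (by fun_prop)]
    refine lintegral_congr fun p => ?_
    unfold inputEnergy
    rw [ENNReal.ofReal_sum_of_nonneg fun _ _ => sq_nonneg _]
    refine Finset.sum_congr rfl fun t _ => ?_
    rw [ENNReal.ofReal_pow (norm_nonneg _), ofReal_norm]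
  have hm : AEStronglyMeasurable (inputEnergy (n := n) (M := M)) c.input :=
    Measurable.aestronglyMeasurable (by fun_prop)
  constructor
  · rw [← lintegral_ofReal_ne_top_iff_integrable hm (ae_of_all _ inputEnergy_nonneg)]
    exact ne_top_of_le_ne_top ENNReal.ofReal_ne_top h1
  · intro hP
    rw [integral_eq_lintegral_of_nonneg_ae (ae_of_all _ inputEnergy_nonneg) hm]
    exact ENNReal.toReal_le_of_le_ofReal (by positivity) h1

end Code

section message

/-- The entropy received through the channel vector `a`, averaged over the conditional input laws
given a uniform message. -/
def condEntropy {N : ℕ} (μs : Fin N → Measure (Fin n → EuclideanSpace ℝ (Fin M)))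
    (a : EuclideanSpace ℝ (Fin M)) : ℝ := (N : ℝ)⁻¹ * ∑ i, recvEntropy (μs i) a

variable {N : ℕ} (μs : Fin N → Measure (Fin n → EuclideanSpace ℝ (Fin M)))
  [∀ i, IsProbabilityMeasure (μs i)]

theorem condEntropy_nonneg (a : EuclideanSpace ℝ (Fin M)) : 0 ≤ condEntropy μs a :=
  mul_nonneg (by positivity) (Finset.sum_nonneg fun _ _ => recvEntropy_nonneg _ a)

variable [NeZero N]

theorem condEntropy_sum_le (hμ : ∀ i, Integrable inputEnergy (μs i)) {m : ℕ}
    (a : Fin m → EuclideanSpace ℝ (Fin M)) (c : Fin m → ℝ) :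
    condEntropy μs (∑ j, c j • a j) ≤ ∑ j, condEntropy μs (a j) +
      n * (1 / 2 * Real.log (2 * Real.pi * (1 + ∑ j, c j ^ 2)) + 1 / 2) := by
  have hN : (0 : ℝ) < N := by exact_mod_cast NeZero.pos N
  have h := mul_le_mul_of_nonneg_left (Finset.sum_le_sum fun i (_ : i ∈ Finset.univ) =>
    recvEntropy_sum_le (μs i) (hμ i) a c) (inv_nonneg.2 hN.le)
  unfold condEntropy
  refine h.trans (le_of_eq ?_)
  rw [Finset.sum_add_distrib, mul_add, Finset.sum_comm, Finset.mul_sum]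
  simp [hN.ne']

theorem fano_recv (hμ : ∀ i, Integrable inputEnergy (μs i)) (a : EuclideanSpace ℝ (Fin M))
    {dec : (Fin n → ℝ) → Fin N} (hdec : Measurable dec) :
    (1 - (jointLaw fun i => (μs i).map (proj a)).real {p | dec p.2 ≠ p.1}) * Real.log N -
      Real.log 2 ≤ recvEntropy (mixture μs) a - condEntropy μs a := by
  have h := fano (fun i => (μs i).map (proj a))
    (fun i => integrable_energy_map_proj (μs i) (hμ i) a) hdec
  rwa [← map_mixture _ (measurable_proj a)] at h

theorem recvEntropy_sub_le_klDiv (hμ : ∀ i, Integrable inputEnergy (μs i))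
    (a : EuclideanSpace ℝ (Fin M)) :
    ENNReal.ofReal (recvEntropy (mixture μs) a - condEntropy μs a) ≤
      InformationTheory.klDiv (jointLaw fun i => (μs i).map (proj a))
        (((jointLaw fun i => (μs i).map (proj a)).map Prod.fst).prod
          ((jointLaw fun i => (μs i).map (proj a)).map Prod.snd)) := by
  have h := entropy_sub_le_klDiv (fun i => (μs i).map (proj a))
    (fun i => integrable_energy_map_proj (μs i) (hμ i) a)
  rwa [← map_mixture _ (measurable_proj a)] at h

end message

variable {J₁ J₂ : ℕ}

namespace Code

variable (c : Code M J₁ J₂ n) (h : Fin J₁ → EuclideanSpace ℝ (Fin M))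
  (g : Fin J₂ → EuclideanSpace ℝ (Fin M))

theorem integrable_inputEnergy_input₁ {P : ℝ} (hc : c.SatisfiesPower P) (i : Fin c.N₁) :
    Integrable inputEnergy (c.input₁ i) :=
  integrable_mixture.1 (c.integrable_inputEnergy hc).1 i

theorem integrable_inputEnergy_input₂ {P : ℝ} (hc : c.SatisfiesPower P) (b : Fin c.N₂) :
    Integrable inputEnergy (c.input₂ b) :=
  integrable_mixture.1 (c.input_eq_mixture_input₂ ▸ (c.integrable_inputEnergy hc).1) b

theorem measurable_output₁ (j : Fin J₁) :
    Measurable fun ω => (c.msg₁ ω, c.output₁ h j ω) := by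
  change Measurable fun ω : c.Sample => (ω.1.1.1, proj (h j) ω.1.2 + ω.2 (Sum.inl j))
  fun_prop

theorem measurable_output₂ (k : Fin J₂) :
    Measurable fun ω => (c.msg₂ ω, c.output₂ g k ω) := by
  change Measurable fun ω : c.Sample => (ω.1.1.2, proj (g k) ω.1.2 + ω.2 (Sum.inr k))
  fun_prop

theorem fano₁ {P : ℝ} (hc : c.SatisfiesPower P) (j : Fin J₁) :
    (1 - (c.errorProb h g).toReal) * Real.log c.N₁ - Real.log 2 ≤
      recvEntropy c.input (h j) - condEntropy c.input₁ (h j) := by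
  have hd := c.measurable_dec₁ j
  refine le_trans ?_ (fano_recv c.input₁ (c.integrable_inputEnergy_input₁ hc) (h j) hd)
  have hS : MeasurableSet {p : Fin c.N₁ × (Fin n → ℝ) | c.dec₁ j p.2 ≠ p.1} :=
    (measurableSet_eq_fun (hd.comp measurable_snd) measurable_fst).compl
  have hle : (jointLaw fun i => (c.input₁ i).map (proj (h j))).real {p | c.dec₁ j p.2 ≠ p.1} ≤
      (c.errorProb h g).toReal := by
    have hJ : c.law.map (fun ω => (c.msg₁ ω, c.output₁ h j ω)) =
        jointLaw fun i => (c.input₁ i).map (proj (h j)) :=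
      c.map_law_msg₁ (Sum.inl j) (h j)
    rw [← hJ, measureReal_def, Measure.map_apply (c.measurable_output₁ h j) hS]
    refine ENNReal.toReal_mono (measure_ne_top _ _) (measure_mono fun ω hω => ?_)
    exact Or.inl ⟨j, hω⟩
  have hlog : 0 ≤ Real.log c.N₁ := Real.log_natCast_nonneg _
  nlinarith

theorem fano₂ {P : ℝ} (hc : c.SatisfiesPower P) (k : Fin J₂) :
    (1 - (c.errorProb h g).toReal) * Real.log c.N₂ - Real.log 2 ≤
      recvEntropy c.input (g k) - condEntropy c.input₂ (g k) := by
  have hd := c.measurable_dec₂ k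
  rw [c.input_eq_mixture_input₂]
  refine le_trans ?_ (fano_recv c.input₂ (c.integrable_inputEnergy_input₂ hc) (g k) hd)
  have hS : MeasurableSet {p : Fin c.N₂ × (Fin n → ℝ) | c.dec₂ k p.2 ≠ p.1} :=
    (measurableSet_eq_fun (hd.comp measurable_snd) measurable_fst).compl
  have hle : (jointLaw fun i => (c.input₂ i).map (proj (g k))).real {p | c.dec₂ k p.2 ≠ p.1} ≤
      (c.errorProb h g).toReal := by
    have hJ : c.law.map (fun ω => (c.msg₂ ω, c.output₂ g k ω)) =
        jointLaw fun i => (c.input₂ i).map (proj (g k)) :=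
      c.map_law_msg₂ (Sum.inr k) (g k)
    rw [← hJ, measureReal_def, Measure.map_apply (c.measurable_output₂ g k) hS]
    refine ENNReal.toReal_mono (measure_ne_top _ _) (measure_mono fun ω hω => ?_)
    exact Or.inr ⟨k, hω⟩
  have hlog : 0 ≤ Real.log c.N₂ := Real.log_natCast_nonneg _
  nlinarith

theorem entropy_sub_le_mutualInfo₁ {P : ℝ} (hc : c.SatisfiesPower P) (k : Fin J₂) :
    ENNReal.ofReal (recvEntropy c.input (g k) - condEntropy c.input₁ (g k)) ≤
      mutualInfo c.msg₁ (c.output₂ g k) c.law := by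
  refine (recvEntropy_sub_le_klDiv c.input₁ (c.integrable_inputEnergy_input₁ hc) (g k)).trans
    (le_of_eq ?_)
  have hm : Measurable fun ω => (c.msg₁ ω, c.output₂ g k ω) := by
    change Measurable fun ω : c.Sample => (ω.1.1.1, proj (g k) ω.1.2 + ω.2 (Sum.inr k))
    fun_prop
  have hJ : c.law.map (fun ω => (c.msg₁ ω, c.output₂ g k ω)) =
      jointLaw fun i => (c.input₁ i).map (proj (g k)) := c.map_law_msg₁ (Sum.inr k) (g k)
  rw [mutualInfo, ← hJ, Measure.map_map measurable_fst hm, Measure.map_map measurable_snd hm]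
  rfl

theorem entropy_sub_le_mutualInfo₂ {P : ℝ} (hc : c.SatisfiesPower P) (j : Fin J₁) :
    ENNReal.ofReal (recvEntropy c.input (h j) - condEntropy c.input₂ (h j)) ≤
      mutualInfo c.msg₂ (c.output₁ h j) c.law := by
  rw [c.input_eq_mixture_input₂]
  refine (recvEntropy_sub_le_klDiv c.input₂ (c.integrable_inputEnergy_input₂ hc) (h j)).trans
    (le_of_eq ?_)
  have hm : Measurable fun ω => (c.msg₂ ω, c.output₁ h j ω) := by
    change Measurable fun ω : c.Sample => (ω.1.1.2, proj (h j) ω.1.2 + ω.2 (Sum.inl j))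
    fun_prop
  have hJ : c.law.map (fun ω => (c.msg₂ ω, c.output₁ h j ω)) =
      jointLaw fun i => (c.input₂ i).map (proj (h j)) := c.map_law_msg₂ (Sum.inl j) (h j)
  rw [mutualInfo, ← hJ, Measure.map_map measurable_fst hm, Measure.map_map measurable_snd hm]
  rfl

end Code

/-! ### Entropy constraints on achievable rates -/

/-- The loss per channel use in replacing a receiver by receivers whose combination, with
coefficients `c`, it is. -/
def combLoss {m : ℕ} (c : Fin m → ℝ) : ℝ :=
  1 / 2 * Real.log (2 * Real.pi * (1 + ∑ j, c j ^ 2)) + 1 / 2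

/-- Received entropies per channel use, as functions of the channel vector, together with the
constraints that a good code of rates `r₁`, `r₂` (in nats) at power `P` imposes on them up to `ε`:
`H` is the entropy of the received signal, `H₁` and `H₂` are its conditional entropies given the
first and the second message. -/
structure EntropyProfile (h : Fin J₁ → EuclideanSpace ℝ (Fin M))
    (g : Fin J₂ → EuclideanSpace ℝ (Fin M)) (P r₁ r₂ ε : ℝ) where
  /-- entropy of the signal received through a channel vector -/
  H : EuclideanSpace ℝ (Fin M) → ℝ
  /-- conditional entropy given the first message -/
  H₁ : EuclideanSpace ℝ (Fin M) → ℝ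
  /-- conditional entropy given the second message -/
  H₂ : EuclideanSpace ℝ (Fin M) → ℝ
  H_le : ∀ a, H a ≤ 1 / 2 * Real.log (1 + P) + (1 / 2 * Real.log (2 * Real.pi) + ‖a‖ ^ 2 + 1)
  H₁_nonneg : ∀ a, 0 ≤ H₁ a
  H₂_nonneg : ∀ a, 0 ≤ H₂ a
  H₁_sum_le : ∀ {m : ℕ} (a : Fin m → EuclideanSpace ℝ (Fin M)) (c : Fin m → ℝ),
    H₁ (∑ j, c j • a j) ≤ ∑ j, H₁ (a j) + combLoss c
  H₂_sum_le : ∀ {m : ℕ} (a : Fin m → EuclideanSpace ℝ (Fin M)) (c : Fin m → ℝ),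
    H₂ (∑ j, c j • a j) ≤ ∑ j, H₂ (a j) + combLoss c
  decodable₁ : ∀ j, r₁ - ε ≤ H (h j) - H₁ (h j)
  decodable₂ : ∀ k, r₂ - ε ≤ H (g k) - H₂ (g k)
  secret₁ : ∀ k, H (g k) - H₁ (g k) ≤ ε
  secret₂ : ∀ j, H (h j) - H₂ (h j) ≤ ε

theorem tendsto_fano {N : ℕ → ℕ} {R : ℝ} {e : ℕ → ℝ≥0∞}
    (hR : Tendsto (fun n => Real.logb 2 (N n) / n) atTop (𝓝 R)) (he : Tendsto e atTop (𝓝 0)) :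
    Tendsto (fun n : ℕ => ((1 - (e n).toReal) * Real.log (N n) - Real.log 2) / n) atTop
      (𝓝 (R * Real.log 2)) := by
  have h2 : Real.log 2 ≠ 0 := (Real.log_pos one_lt_two).ne'
  have h1 : Tendsto (fun n => (e n).toReal) atTop (𝓝 0) := by
    have := (ENNReal.tendsto_toReal ENNReal.zero_ne_top).comp he
    rwa [ENNReal.toReal_zero] at this
  have h3 : Tendsto (fun n : ℕ => (1 - (e n).toReal) * (Real.logb 2 (N n) / n * Real.log 2) -
      Real.log 2 / n) atTop (𝓝 ((1 - 0) * (R * Real.log 2) - 0)) :=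
    ((tendsto_const_nhds.sub h1).mul (hR.mul_const _)).sub
      (tendsto_const_div_atTop_nhds_zero_nat _)
  simp only [sub_zero, one_mul] at h3
  refine h3.congr fun n => ?_
  rw [Real.logb]
  field_simp

theorem eventually_le_of_mutualInfo {I : ℕ → ℝ≥0∞} {x : ℕ → ℝ}
    (hI : Tendsto (fun n : ℕ => I n / (n : ℝ≥0∞)) atTop (𝓝 0))
    (hx : ∀ n, ENNReal.ofReal (x n) ≤ I n) {ε : ℝ} (hε : 0 < ε) :
    ∀ᶠ n : ℕ in atTop, x n / n ≤ ε := by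
  filter_upwards [hI.eventually (gt_mem_nhds (ENNReal.ofReal_pos.2 hε)), eventually_gt_atTop 0]
    with n hn hn0
  have hn' : (0 : ℝ) < n := by exact_mod_cast hn0
  have h1 : ENNReal.ofReal (x n / n) ≤ ENNReal.ofReal ε := by
    rw [ENNReal.ofReal_div_of_pos hn', ENNReal.ofReal_natCast]
    exact (ENNReal.div_le_div_right (hx n) _).trans hn.le
  exact (ENNReal.ofReal_le_ofReal_iff hε.le).1 h1

/-- Slack `ε` absorbs all terms that vanish with the block length, so one long code suffices. -/
theorem AchievableRatePair.nonempty_entropyProfile {h : Fin J₁ → EuclideanSpace ℝ (Fin M)}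
    {g : Fin J₂ → EuclideanSpace ℝ (Fin M)} {P R₁ R₂ : ℝ} (hP : 0 < P)
    (hR : AchievableRatePair h g P R₁ R₂) {ε : ℝ} (hε : 0 < ε) :
    Nonempty (EntropyProfile h g P (R₁ * Real.log 2) (R₂ * Real.log 2) ε) := by
  obtain ⟨c, hpow, hR₁, hR₂, herr, hs₁, hs₂⟩ := hR
  have e₁ := (tendsto_fano hR₁ herr).eventually (lt_mem_nhds (sub_lt_self _ hε))
  have e₂ := (tendsto_fano hR₂ herr).eventually (lt_mem_nhds (sub_lt_self _ hε))
  have e₃ := eventually_all.2 fun k => eventually_le_of_mutualInfo (hs₁ k)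
    (fun n => (c n).entropy_sub_le_mutualInfo₁ g (hpow n) k) hε
  have e₄ := eventually_all.2 fun j => eventually_le_of_mutualInfo (hs₂ j)
    (fun n => (c n).entropy_sub_le_mutualInfo₂ h (hpow n) j) hε
  obtain ⟨n, d₁, d₂, s₁, s₂, hn⟩ :=
    (e₁.and (e₂.and (e₃.and (e₄.and (eventually_gt_atTop 0))))).exists
  have hn' : (0 : ℝ) < n := by exact_mod_cast hn
  obtain ⟨hint, hpw⟩ := (c n).integrable_inputEnergy (hpow n)
  have hpw := hpw hP.le
  refine ⟨⟨fun a => recvEntropy (c n).input a / n, fun a => condEntropy (c n).input₁ a / n,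
    fun a => condEntropy (c n).input₂ a / n, fun a => ?_, fun a => ?_, fun a => ?_,
    fun a w => ?_, fun a w => ?_, fun j => ?_, fun k => ?_, fun k => ?_, fun j => ?_⟩⟩
  · rw [div_le_iff₀ hn', mul_comm]
    exact recvEntropy_le _ hint hP hpw a
  · exact div_nonneg (condEntropy_nonneg _ a) hn'.le
  · exact div_nonneg (condEntropy_nonneg _ a) hn'.le
  · rw [div_le_iff₀ hn', add_mul, ← Finset.sum_div, div_mul_cancel₀ _ hn'.ne', mul_comm (combLoss w)]
    exact condEntropy_sum_le _ ((c n).integrable_inputEnergy_input₁ (hpow n)) a w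
  · rw [div_le_iff₀ hn', add_mul, ← Finset.sum_div, div_mul_cancel₀ _ hn'.ne', mul_comm (combLoss w)]
    exact condEntropy_sum_le _ ((c n).integrable_inputEnergy_input₂ (hpow n)) a w
  · rw [← sub_div]
    exact d₁.le.trans (div_le_div_of_nonneg_right ((c n).fano₁ h g (hpow n) j) hn'.le)
  · rw [← sub_div]
    exact d₂.le.trans (div_le_div_of_nonneg_right ((c n).fano₂ h g (hpow n) k) hn'.le)
  · rw [← sub_div]
    exact s₁ k
  · rw [← sub_div]
    exact s₂ j

/-- The same profile with the roles of the two groups exchanged. -/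
def EntropyProfile.swap {h : Fin J₁ → EuclideanSpace ℝ (Fin M)}
    {g : Fin J₂ → EuclideanSpace ℝ (Fin M)} {P r₁ r₂ ε : ℝ} (p : EntropyProfile h g P r₁ r₂ ε) :
    EntropyProfile g h P r₂ r₁ ε where
  H := p.H
  H₁ := p.H₂
  H₂ := p.H₁
  H_le := p.H_le
  H₁_nonneg := p.H₂_nonneg
  H₂_nonneg := p.H₁_nonneg
  H₁_sum_le := p.H₂_sum_le
  H₂_sum_le := p.H₁_sum_le
  decodable₁ := p.decodable₂
  decodable₂ := p.decodable₁
  secret₁ := p.secret₂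
  secret₂ := p.secret₁

/-- The channel vectors of the first `M` receivers of a group span the space. -/
theorem AnyIndependent.exists_sum_eq {h : Fin J₁ → EuclideanSpace ℝ (Fin M)}
    {g : Fin J₂ → EuclideanSpace ℝ (Fin M)} (hind : AnyIndependent h g)
    (h_inj : Function.Injective h) (hJ : M ≤ J₁) (b : EuclideanSpace ℝ (Fin M)) :
    ∃ c : Fin M → ℝ, b = ∑ j, c j • h (Fin.castLE hJ j) := by
  classical
  set a : Fin M → EuclideanSpace ℝ (Fin M) := fun j => h (Fin.castLE hJ j) with ha
  have a_inj : Function.Injective a := h_inj.comp (Fin.castLE_injective hJ)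
  have hli : LinearIndependent ℝ a := by
    have h1 := hind (Finset.univ.image a) (by
      intro x hx
      simp only [Finset.coe_image, Finset.coe_univ, Set.image_univ] at hx
      obtain ⟨j, rfl⟩ := hx
      exact Or.inl ⟨_, rfl⟩) (Finset.card_image_le.trans (by simp))
    simp only [Finset.coe_image, Finset.coe_univ, Set.image_univ] at h1
    exact (linearIndepOn_id_range_iff a_inj).1 h1
  have hspan : Submodule.span ℝ (Set.range a) = ⊤ :=
    hli.span_eq_top_of_card_eq_finrank' (by simp)
  have hb : b ∈ Submodule.span ℝ (Set.range a) := hspan ▸ Submodule.mem_top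
  obtain ⟨c, hc⟩ := (Submodule.mem_span_range_iff_exists_fun ℝ).1 hb
  exact ⟨c, hc.symm⟩

theorem AnyIndependent.swap {h : Fin J₁ → EuclideanSpace ℝ (Fin M)}
    {g : Fin J₂ → EuclideanSpace ℝ (Fin M)} (hind : AnyIndependent h g) : AnyIndependent g h :=
  fun S hS => hind S (Set.union_comm _ _ ▸ hS)

/-! ### Bounds on the sum rate -/

/-- The part of the single-receiver capacity bound that does not depend on the power. -/
def gainConst (a : EuclideanSpace ℝ (Fin M)) : ℝ := 1 / 2 * Real.log (2 * Real.pi) + ‖a‖ ^ 2 + 1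

section profile

variable {h : Fin J₁ → EuclideanSpace ℝ (Fin M)} {g : Fin J₂ → EuclideanSpace ℝ (Fin M)}
  {P r₁ r₂ ε : ℝ}

/-- The first message is decoded by `M` receivers that together determine the input, hence the
signal of receiver `k`, which keeps all of its entropy when the first message is given. -/
theorem EntropyProfile.mul_add_le (p : EntropyProfile h g P r₁ r₂ ε) (hJ : M ≤ J₁) {k : Fin J₂}
    {c : Fin M → ℝ} (hc : g k = ∑ j, c j • h (Fin.castLE hJ j)) :
    M * (r₁ - ε) + p.H (g k) ≤ ∑ j, p.H (h (Fin.castLE hJ j)) + ε + combLoss c := by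
  have h1 := Finset.sum_le_sum fun j (_ : j ∈ (Finset.univ : Finset (Fin M))) =>
    p.decodable₁ (Fin.castLE hJ j)
  simp only [Finset.sum_const, Finset.card_univ, Fintype.card_fin, nsmul_eq_mul,
    Finset.sum_sub_distrib] at h1
  have h2 := p.H₁_sum_le (fun j => h (Fin.castLE hJ j)) c
  rw [← hc] at h2
  linarith [p.secret₁ k]

theorem EntropyProfile.sum_H_le (p : EntropyProfile h g P r₁ r₂ ε)
    (a : Fin M → EuclideanSpace ℝ (Fin M)) :
    ∑ j, p.H (a j) ≤ M * (1 / 2 * Real.log (1 + P)) + ∑ j, gainConst (a j) := by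
  have h1 := Finset.sum_le_sum fun j (_ : j ∈ (Finset.univ : Finset (Fin M))) => p.H_le (a j)
  simp only [Finset.sum_add_distrib, Finset.sum_const, Finset.card_univ, Fintype.card_fin,
    nsmul_eq_mul] at h1
  simp only [gainConst, Finset.sum_add_distrib, Finset.sum_const, Finset.card_univ,
    Fintype.card_fin, nsmul_eq_mul]
  linarith

theorem EntropyProfile.add_le_two (p : EntropyProfile h g P r₁ r₂ 1) (j : Fin J₁) (k : Fin J₂) :
    r₁ + r₂ ≤ 2 * (1 / 2 * Real.log (1 + P)) + (gainConst (h j) + gainConst (g k) + 2) := by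
  unfold gainConst
  linarith [p.decodable₁ j, p.decodable₂ k, p.H₁_nonneg (h j), p.H₂_nonneg (g k), p.H_le (h j),
    p.H_le (g k)]

/-- The sum-rate bound when group 1 has at least `M` receivers. -/
theorem EntropyProfile.add_le_of_le (p : EntropyProfile h g P r₁ r₂ 1) (hM : 1 ≤ M) (hJ : M ≤ J₁)
    {k : Fin J₂} {c : Fin M → ℝ} (hc : g k = ∑ j, c j • h (Fin.castLE hJ j)) :
    r₁ + r₂ ≤ (2 * (M : ℝ) - 1) / M * (1 / 2 * Real.log (1 + P)) +
      (∑ j, gainConst (h (Fin.castLE hJ j)) + (M - 1) * gainConst (g k) + combLoss c +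
        2 * M + 1) / M := by
  have hM' : (1 : ℝ) ≤ M := by exact_mod_cast hM
  have h1 := p.mul_add_le hJ hc
  have h2 : (M : ℝ) * (r₂ - 1) ≤ M * p.H (g k) :=
    mul_le_mul_of_nonneg_left (by linarith [p.decodable₂ k, p.H₂_nonneg (g k)]) (by linarith)
  have h3 := p.sum_H_le fun j => h (Fin.castLE hJ j)
  have h4 : ((M : ℝ) - 1) * p.H (g k) ≤
      (M - 1) * (1 / 2 * Real.log (1 + P) + gainConst (g k)) :=
    mul_le_mul_of_nonneg_left (p.H_le (g k)) (by linarith)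
  rw [div_mul_eq_mul_div, ← add_div, le_div_iff₀ (by linarith)]
  linarith

/-- The sum-rate bound when both groups have at least `M` receivers. -/
theorem EntropyProfile.add_le_of_le_of_le (p : EntropyProfile h g P r₁ r₂ 1) (hM : 1 ≤ M)
    (hJ₁ : M ≤ J₁) (hJ₂ : M ≤ J₂) {c d : Fin M → Fin M → ℝ}
    (hc : ∀ k, g (Fin.castLE hJ₂ k) = ∑ j, c k j • h (Fin.castLE hJ₁ j))
    (hd : ∀ j, h (Fin.castLE hJ₁ j) = ∑ k, d j k • g (Fin.castLE hJ₂ k)) :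
    r₁ + r₂ ≤ 2 * ((M : ℝ) - 1) / M * (1 / 2 * Real.log (1 + P)) +
      ((M - 1) * (∑ j, gainConst (h (Fin.castLE hJ₁ j)) + ∑ k, gainConst (g (Fin.castLE hJ₂ k))) +
        ∑ k, combLoss (c k) + ∑ j, combLoss (d j) + 2 * M + 2 * M ^ 2) / M ^ 2 := by
  have hM' : (1 : ℝ) ≤ M := by exact_mod_cast hM
  have h1 := Finset.sum_le_sum fun k (_ : k ∈ (Finset.univ : Finset (Fin M))) =>
    p.mul_add_le hJ₁ (hc k)
  have h2 := Finset.sum_le_sum fun j (_ : j ∈ (Finset.univ : Finset (Fin M))) =>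
    p.swap.mul_add_le hJ₂ (hd j)
  simp only [Finset.sum_add_distrib, Finset.sum_const, Finset.card_univ, Fintype.card_fin,
    nsmul_eq_mul, mul_one] at h1 h2
  have hswap : p.swap.H = p.H := rfl
  rw [hswap] at h2
  have h3 := mul_le_mul_of_nonneg_left (p.sum_H_le fun j => h (Fin.castLE hJ₁ j))
    (sub_nonneg.2 hM')
  have h4 := mul_le_mul_of_nonneg_left (p.sum_H_le fun k => g (Fin.castLE hJ₂ k))
    (sub_nonneg.2 hM')
  have h5 : 2 * ((M : ℝ) - 1) / M * (1 / 2 * Real.log (1 + P)) =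
      2 * ((M : ℝ) - 1) * M * (1 / 2 * Real.log (1 + P)) / M ^ 2 := by
    field_simp
  rw [h5, ← add_div, le_div_iff₀ (by positivity)]
  linarith

end profile

/-- A sum-rate bound `κ · ½ log (1 + P) + O(1)` gives `κ` as a bound on the degrees of freedom. -/
theorem sumSecrecyDOF_le {h : Fin J₁ → EuclideanSpace ℝ (Fin M)}
    {g : Fin J₂ → EuclideanSpace ℝ (Fin M)} {κ C : ℝ} (hκ : 0 ≤ κ)
    (hb : ∀ P r₁ r₂ : ℝ, EntropyProfile h g P r₁ r₂ 1 →
      r₁ + r₂ ≤ κ * (1 / 2 * Real.log (1 + P)) + C) :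
    sumSecrecyDOF h g ≤ (κ : EReal) := by
  refine sSup_le ?_
  rintro _ ⟨d, ⟨R₁, R₂, hR, hd⟩, rfl⟩
  refine EReal.coe_le_coe_iff.2 ?_
  have hlim : Tendsto (fun P : ℝ => κ + (κ * Real.log 2 + 2 * C) / Real.log P) atTop (𝓝 (κ + 0)) :=
    tendsto_const_nhds.add (tendsto_const_nhds.div_atTop Real.tendsto_log_atTop)
  rw [add_zero] at hlim
  refine le_of_tendsto_of_tendsto hd hlim ?_
  filter_upwards [eventually_gt_atTop 1] with P hP
  have hP0 : 0 < P := by linarith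
  obtain ⟨p⟩ := (hR P hP0).nonempty_entropyProfile hP0 one_pos
  have h1 := hb P _ _ p
  have hlog : 0 < Real.log P := Real.log_pos hP
  have hlog2 : 0 < Real.log 2 := Real.log_pos one_lt_two
  have h2 : Real.log (1 + P) ≤ Real.log 2 + Real.log P := by
    rw [← Real.log_mul two_ne_zero hP0.ne']
    exact Real.log_le_log (by linarith) (by linarith)
  have h3 := mul_le_mul_of_nonneg_left h2 hκ
  have h4 : (R₁ P + R₂ P) / (1 / 2 * Real.logb 2 P) =
      2 * ((R₁ P + R₂ P) * Real.log 2) / Real.log P := by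
    rw [Real.logb]
    field_simp
  rw [h4, ← sub_le_iff_le_add', div_sub' hlog.ne']
  refine div_le_div_of_nonneg_right ?_ hlog.le
  nlinarith

end CompoundPrivateBroadcast

end

theorem theorem4 (M J₁ J₂ : ℕ) (hM : 1 ≤ M) (hJ₁ : 1 ≤ J₁) (hJ₂ : 1 ≤ J₂)
    (h : Fin J₁ → EuclideanSpace ℝ (Fin M)) (g : Fin J₂ → EuclideanSpace ℝ (Fin M))
    (h_inj : Function.Injective h) (g_inj : Function.Injective g)
    (h_ind : CompoundPrivateBroadcast.AnyIndependent h g) :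
    (max J₁ J₂ < M →
      CompoundPrivateBroadcast.sumSecrecyDOF h g ≤ ((2 : ℝ) : EReal)) ∧
    (min J₁ J₂ < M → M ≤ max J₁ J₂ →
      CompoundPrivateBroadcast.sumSecrecyDOF h g ≤ (((2 * (M : ℝ) - 1) / (M : ℝ) : ℝ) : EReal)) ∧
    (M ≤ min J₁ J₂ →
      CompoundPrivateBroadcast.sumSecrecyDOF h g ≤
        ((2 * ((M : ℝ) - 1) / (M : ℝ) : ℝ) : EReal)) := by
  have hM' : (1 : ℝ) ≤ M := by exact_mod_cast hM
  refine ⟨fun _ => ?_, fun _ hmax => ?_, fun hmin => ?_⟩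
  · exact CompoundPrivateBroadcast.sumSecrecyDOF_le zero_le_two fun P r₁ r₂ p =>
      p.add_le_two ⟨0, hJ₁⟩ ⟨0, hJ₂⟩
  · have hκ : 0 ≤ (2 * (M : ℝ) - 1) / M := div_nonneg (by linarith) (by linarith)
    rcases le_max_iff.1 hmax with hJ | hJ
    · obtain ⟨c, hc⟩ := h_ind.exists_sum_eq h_inj hJ (g ⟨0, hJ₂⟩)
      exact CompoundPrivateBroadcast.sumSecrecyDOF_le hκ fun P r₁ r₂ p => p.add_le_of_le hM hJ hc
    · obtain ⟨c, hc⟩ := h_ind.swap.exists_sum_eq g_inj hJ (h ⟨0, hJ₁⟩)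
      exact CompoundPrivateBroadcast.sumSecrecyDOF_le hκ fun P r₁ r₂ p =>
        (add_comm r₁ r₂).trans_le (p.swap.add_le_of_le hM hJ hc)
  · have hκ : 0 ≤ 2 * ((M : ℝ) - 1) / M := div_nonneg (by linarith) (by linarith)
    obtain ⟨h1, h2⟩ := le_min_iff.1 hmin
    choose c hc using fun k => h_ind.exists_sum_eq h_inj h1 (g (Fin.castLE h2 k))
    choose d hd using fun j => h_ind.swap.exists_sum_eq g_inj h2 (h (Fin.castLE h1 j))
    exact CompoundPrivateBroadcast.sumSecrecyDOF_le hκ fun P r₁ r₂ p =>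
      p.add_le_of_le_of_le hM h1 h2 hc hd
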